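/- Let $M=\{\mathrm{x}\in\mathbb{R}^2:\ |\mathrm{x}|\le 1\}$ be the closed Euclidean unit disc, $SM=M\times\mathbb{S}^1$ with the measure $d\mathrm{x}\,d\theta$, and let $\|u\|^2=\int_{SM}|u|^2\,d\mathrm{x}\,d\theta$ and $\|f\|_M^2=\int_M|f|^2\,d\mathrm{x}$ (all functions are complex valued). For $k\ge 0$ let $H_k\subset L^2(SM)$ be the space of functions $p(\mathrm{x})e^{ik\theta}+q(\mathrm{x})e^{-ik\theta}$ with $p,q\in L^2(M)$ (for $k=0$: functions of $\mathrm{x}$ alone), and for $m\ge 0$ let $L^2_{(m)}(SM)=\bigoplus_{k=0}^m H_k$. For $k\ge1$ let $H_k^{\mathrm{sol}}\subset H_k$ be the subspace where $p$ is holomorphic and $q$ is antiholomorphic in the interior of $M$, with respect to $z=x+iy$. Let $H^1_0(M)$ be the closure of $C_c^\infty(\mathrm{int}\,M)$ in the $H^1$ norm, let $X_\perp=\sin\theta\,\partial_x-\cos\theta\,\partial_y$, and let $C_P$ be the Poincaré constant of $M$, i.e. the least $C>0$ such that $\|u\|_M^2\le C\|\nabla u\|_M^2$ for all $u\in H^1_0(M)$.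 Parameterize the ingoing boundary $\partial_+SM$ by $(\beta,\alpha)\in\mathbb{S}^1\times[-\pi/2,\pi/2]$, the base point being $(\cos\beta,\sin\beta)$ and the direction $v$ having angle $\beta+\pi+\alpha$, with the measure $d\beta\,d\alpha$. For $a\in C^0(M,\mathbb{C})$ and $f\in L^2(SM)$, the attenuated X-ray transform of $f$ is defined for almost every $(\mathrm{x},v)\in\partial_+SM$ by $$I_af(\mathrm{x},v)=\int_0^{2\cos\alpha} f(\mathrm{x}+tv,v)\,\exp\Big(\int_0^t a(\mathrm{x}+sv)\,ds\Big)\,dt .$$ **Theorem.** Let $a\in C^0(M,\mathbb{C})$ with $a_\infty=\sup_M|a|$, and let $m\ge 0$ be an integer. For every $f=\sum_{k=0}^m f_k\in L^2_{(m)}(SM)$, with $f_k\in H_k$, there exists $g\in L^2_{(m)}(SM)$, depending linearly on $f$, such that $I_af=I_ag$ (almost everywhere on $\partial_+SM$) and $$g=g_0+X_\perp g_s+\sum_{k=1}^m g_k,\qquad g_0\in L^2(M),\quad g_s\in H^1_0(M),\quad g_k\in H^{\mathrm{sol}}_k\ (1\le k\le m).$$ Moreover, with $C:=4+8a_\infty^2C_P$,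 $$\|g\|^2\le 2\|f_0\|^2+(1+4a_\infty^2C_P)\|f_1\|^2\quad\text{if } m=1,$$ $$\|g\|^2\le 4\sum_{p=0}^{m-2}C^p\|f_p\|^2+2C^{m-1}\|f_{m-1}\|^2+C^m\|f_m\|^2\quad\text{if } m\ge2.$$ -/

import Mathlib

open MeasureTheory
open scoped ContDiff ComplexConjugate

noncomputable section

namespace AttXray

/-- The closed unit disc `M`, in the plane `ℝ² = ℂ` with coordinate `z = x + i y`. -/
def disc : Set ℂ := Metric.closedBall 0 1

instance factTwoPiPos : Fact (0 < 2 * Real.pi) := ⟨Real.two_pi_pos⟩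

/-- The circle `𝕊¹ = ℝ / 2πℤ` of angles `θ`; its `volume` is `dθ`, of total mass `2π`. -/
abbrev Circ : Type := AddCircle (2 * Real.pi)

/-- Lebesgue measure `dx` on `M`. -/
def volM : Measure ℂ := volume.restrict disc

/-- The measure `dx dθ` on `SM = M × 𝕊¹`. -/
def volSM : Measure (ℂ × Circ) := volM.prod volume

/-- `L²(M)`, with `‖f‖² = ∫_M |f|² dx`. -/
abbrev L2M : Type := Lp ℂ 2 volM

/-- `L²(SM)`, with `‖u‖² = ∫_{SM} |u|² dx dθ`. -/
abbrev L2SM : Type := Lp ℂ 2 volSM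

/-- The unit vector `cos θ + i sin θ` of angle `θ`. -/
def dir (θ : Circ) : ℂ := (AddCircle.toCircle θ : ℂ)

/-! ### Angular harmonics -/

/-- The function `p(x) e^{ikθ} + q(x) e^{-ikθ}` on `SM`
(`fourier k θ` is `e^{ikθ}`, the period being `2π`). -/
def harmonicFun (k : ℕ) (p q : ℂ → ℂ) (s : ℂ × Circ) : ℂ :=
  p s.1 * fourier (k : ℤ) s.2 + q s.1 * fourier (-(k : ℤ)) s.2

/-- The space `H_k` of angular harmonics of order `k`: all `p(x) e^{ikθ} + q(x) e^{-ikθ}` with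
`p, q ∈ L²(M)`. For `k = 0` these are the functions of `x` alone. -/
def H (k : ℕ) : Submodule ℂ L2SM where
  carrier := {u | ∃ p q : L2M, u =ᵐ[volSM] harmonicFun k p q}
  zero_mem' := by
    have h0 : ∀ᵐ s ∂volSM, (0 : L2M) s.1 = 0 :=
      Measure.quasiMeasurePreserving_fst.ae (Lp.coeFn_zero ℂ 2 volM)
    refine ⟨0, 0, ?_⟩
    filter_upwards [Lp.coeFn_zero ℂ 2 volSM, h0] with s h1 h2
    rw [h1]
    simp only [harmonicFun, h2]
    simp
  add_mem' := by
    rintro u v ⟨p, q, hu⟩ ⟨p', q', hv⟩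
    have hp : ∀ᵐ s ∂volSM, (p + p') s.1 = p s.1 + p' s.1 :=
      Measure.quasiMeasurePreserving_fst.ae (Lp.coeFn_add p p')
    have hq : ∀ᵐ s ∂volSM, (q + q') s.1 = q s.1 + q' s.1 :=
      Measure.quasiMeasurePreserving_fst.ae (Lp.coeFn_add q q')
    refine ⟨p + p', q + q', ?_⟩
    filter_upwards [hu, hv, hp, hq, Lp.coeFn_add u v] with s h1 h2 h3 h4 h5
    rw [h5, Pi.add_apply, h1, h2]
    simp only [harmonicFun, h3, h4]
    ring
  smul_mem' := by
    rintro c u ⟨p, q, hu⟩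
    have hp : ∀ᵐ s ∂volSM, (c • p) s.1 = c * p s.1 :=
      Measure.quasiMeasurePreserving_fst.ae (Lp.coeFn_smul c p)
    have hq : ∀ᵐ s ∂volSM, (c • q) s.1 = c * q s.1 :=
      Measure.quasiMeasurePreserving_fst.ae (Lp.coeFn_smul c q)
    refine ⟨c • p, c • q, ?_⟩
    filter_upwards [hu, hp, hq, Lp.coeFn_smul c u] with s h1 h2 h3 h4
    rw [h4, Pi.smul_apply, h1]
    simp only [harmonicFun, h2, h3, smul_eq_mul]
    ring

/-- `L²_(m)(SM) = H_0 ⊕ ⋯ ⊕ H_m`. -/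
def L2Deg (m : ℕ) : Submodule ℂ L2SM := ⨆ k ∈ Finset.range (m + 1), H k

/-- `p ∈ L²(ker ∂̄)`: `p` is (almost everywhere) a holomorphic function on the open disc. -/
def IsHolo (p : L2M) : Prop :=
  ∃ h : ℂ → ℂ, DifferentiableOn ℂ h (Metric.ball 0 1) ∧ p =ᵐ[volM] h

/-- `q ∈ L²(ker ∂)`: `q` is (almost everywhere) an antiholomorphic function on the open disc,
that is, the conjugate of a holomorphic one. -/
def IsAntiholo (q : L2M) : Prop :=
  ∃ h : ℂ → ℂ, DifferentiableOn ℂ h (Metric.ball 0 1) ∧ q =ᵐ[volM] fun z => conj (h z)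

/-- The space `H_k^sol`: all `p(x) e^{ikθ} + q(x) e^{-ikθ}` with `p ∈ L²(ker ∂̄)` and
`q ∈ L²(ker ∂)`. -/
def Hsol (k : ℕ) : Set L2SM :=
  {u | ∃ p q : L2M, IsHolo p ∧ IsAntiholo q ∧ u =ᵐ[volSM] harmonicFun k p q}

/-! ### The Sobolev space `H¹₀(M)` -/

/-- `φ ∈ C_c^∞` of the open disc, complex valued. -/
def IsTest (φ : ℂ → ℂ) : Prop :=
  ContDiff ℝ ∞ φ ∧ HasCompactSupport φ ∧ tsupport φ ⊆ Metric.ball 0 1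

/-- `∂φ/∂x`. -/
def dx (φ : ℂ → ℂ) (z : ℂ) : ℂ := fderiv ℝ φ z 1

/-- `∂φ/∂y`. -/
def dy (φ : ℂ → ℂ) (z : ℂ) : ℂ := fderiv ℝ φ z Complex.I

/-- `(p, q)` is the weak gradient `(∂u/∂x, ∂u/∂y)` of `u` on the open disc. -/
def HasWeakGrad (u p q : L2M) : Prop :=
  ∀ φ : ℂ → ℂ, IsTest φ →
    (∫ z, u z * dx φ z ∂volM = -∫ z, p z * φ z ∂volM) ∧
    (∫ z, u z * dy φ z ∂volM = -∫ z, q z * φ z ∂volM)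

/-- The triples `(φ, ∂φ/∂x, ∂φ/∂y)` in `L²(M)³`, for test functions `φ`. -/
def testGraph : Set (L2M × L2M × L2M) :=
  {t | ∃ φ : ℂ → ℂ, IsTest φ ∧
    t.1 =ᵐ[volM] φ ∧ t.2.1 =ᵐ[volM] dx φ ∧ t.2.2 =ᵐ[volM] dy φ}

/-- `u ∈ H¹₀(M)`, with weak gradient `(p, q)`: `H¹₀(M)` is the closure of `C_c^∞` of the open disc
in the norm `(‖u‖² + ‖∇u‖²)^{1/2}`. -/
def HasH10Grad (u p q : L2M) : Prop :=
  HasWeakGrad u p q ∧ (u, p, q) ∈ closure testGraph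

/-- The function `X_⊥ u = sin θ ∂u/∂x - cos θ ∂u/∂y` on `SM`, where `(p, q)` is the gradient
of the function `u` on `M`. -/
def xPerp (p q : ℂ → ℂ) (s : ℂ × Circ) : ℂ :=
  ((dir s.2).im : ℂ) * p s.1 - ((dir s.2).re : ℂ) * q s.1

/-- The Poincaré constant `C_P` of the disc: the least `C > 0` such that
`‖u‖² ≤ C ‖∇u‖²` for all `u ∈ H¹₀(M)`. -/
def poincareConst : ℝ :=
  sInf {C : ℝ | 0 < C ∧ ∀ u p q : L2M, HasH10Grad u p q → ‖u‖ ^ 2 ≤ C * (‖p‖ ^ 2 + ‖q‖ ^ 2)}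

/-! ### The attenuated X-ray transform -/

/-- The measure `dβ dα` on the ingoing boundary `∂₊SM`, in the fan-beam coordinates
`(β, α)`, `-π/2 ≤ α ≤ π/2`: the base point is `e^{iβ}` and the direction has angle `β + π + α`. -/
def volBdry : Measure (Circ × ℝ) :=
  (volume : Measure Circ).prod (volume.restrict (Set.Icc (-(Real.pi / 2)) (Real.pi / 2)))

/-- The angle `β + π + α` of the ingoing direction with fan-beam coordinates `(β, α)`. -/
def fanAngle (b : Circ × ℝ) : Circ := b.1 + ((Real.pi + b.2 : ℝ) : Circ)

/-- The geodesic `γ(t) = x + t v` that enters `M` with fan-beam coordinates `(β, α)`; it lies in `M`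
exactly for `0 ≤ t ≤ 2 cos α`. -/
def geod (b : Circ × ℝ) (t : ℝ) : ℂ := dir b.1 + (t : ℂ) * dir (fanAngle b)

/-- The attenuated X-ray transform
`I_a f = ∫_0^τ f(γ(t), v) exp (∫_0^t a(γ(s)) ds) dt`, with `τ = 2 cos α`. For `f ∈ L²(SM)` the
integral converges for almost every `(β, α)`, and as an almost everywhere defined function
`I_a f` depends only on the class of `f`. -/
def attXray (a : ℂ → ℂ) (f : ℂ × Circ → ℂ) (b : Circ × ℝ) : ℂ :=
  ∫ t in (0 : ℝ)..(2 * Real.cos b.2),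
    f (geod b t, fanAngle b) * Complex.exp (∫ s in (0 : ℝ)..t, a (geod b s))

/-- `a_∞ = sup_M |a|`. -/
def supM (a : ℂ → ℂ) : ℝ := sSup ((fun z => ‖a z‖) '' disc)

/-- `C = 4 + 8 a_∞² C_P`. -/
def stabConst (a : ℂ → ℂ) : ℝ := 4 + 8 * supM a ^ 2 * poincareConst

end AttXray

end

/-!
The operator `X + a`, with `X = cos θ ∂/∂x + sin θ ∂/∂y = e^{iθ} ∂ + e^{-iθ} ∂̄`, differentiates
along the geodesics, so `I_a ((X + a) u) = 0` whenever `u` vanishes on the boundary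
(`transport_mem_xrayKer`). For a test function this is the fundamental theorem of calculus along
each chord. It passes to `u = w(x) e^{inθ}` with `w ∈ H¹₀(M)` because the kernel of `I_a` in
`L²(SM)` is closed (`isClosed_xrayKer`), which comes from the inequality in Santaló's formula
(`santalo_le`).

Every `p ∈ L²(M)` is the orthogonal sum of a holomorphic function and some `∂w`, `w ∈ H¹₀(M)`, and
likewise with `∂̄` and antiholomorphic functions. Indeed `∂H¹₀` is closed, by the Poincaré
inequality and `‖∂w‖² = ‖∇w‖² / 4` (`norm_wirt_sq`), and the orthogonal complement of `∂H¹₀`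
consists of the weakly holomorphic functions, which are holomorphic by Weyl's lemma (`weyl`).

Given the component `p e^{ikθ} + q e^{-ikθ}` of order `k ≥ 2` of `f`, write `p = s + ∂w` and `q =
t + ∂̄v`. Subtracting `(X + a)(w e^{i(k-1)θ} + v e^{-i(k-1)θ})` from `f` leaves `I_a f` unchanged,
reduces the component of order `k` to its solenoidal part `s e^{ikθ} + t e^{-ikθ}`, and changes
only the components of order `k - 1` (by `a w`, `a v`) and `k - 2` (by `∂̄w`, `∂v`). For `k = 1`,
subtracting `(X + a)(w + v) / 2` leaves in addition `X_⊥ (v - w) / (2 i)`. Doing this for `k = m,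
m - 1, …, 1` (`gauge`, `reduce`) gives `g`. The bounds on `‖g‖²` follow by induction on `m`
(`reducedEnergy_le`) from the estimates of a single reduction, in which the squared norm `r²`
removed from the component of order `k` pays for what is added to the lower ones: the
orthogonality of the decompositions makes the former drop by exactly `r²`, while `‖a w‖² ≤ 4 a_∞²
C_P ‖∂w‖²` and `‖∂̄w‖ = ‖∂w‖`.
-/

noncomputable section

namespace AttXray

open Complex Filter Topology InnerProductSpace

/-! ### Fourier modes in the angle -/

instance : IsFiniteMeasure volM :=
  ⟨by rw [volM, Measure.restrict_apply_univ]; exact (isCompact_closedBall _ _).measure_lt_top⟩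

instance : IsFiniteMeasure volSM := inferInstanceAs (IsFiniteMeasure (volM.prod volume))

lemma measurableSet_disc : MeasurableSet disc := Metric.isClosed_closedBall.measurableSet

/-- A property that holds almost everywhere on `M` holds, in the base point, almost everywhere
on `SM`. -/
lemma ae_fst {P : ℂ → Prop} (h : ∀ᵐ z ∂volM, P z) : ∀ᵐ s ∂volSM, P s.1 :=
  Measure.quasiMeasurePreserving_fst.ae h

lemma memLp_mode (n : ℤ) (p : L2M) :
    MemLp (fun s : ℂ × Circ => p s.1 * fourier n s.2) 2 volSM := by
  have h1 : MemLp (fun s : ℂ × Circ => p s.1) 2 volSM := (Lp.memLp p).comp_fst volume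
  refine h1.of_le (h1.1.mul (by fun_prop)) (Eventually.of_forall fun s => ?_)
  rw [norm_mul, fourier_apply, Circle.norm_coe, mul_one]

/-- The function `p(x) e^{inθ}` of `L²(SM)`, linearly in `p ∈ L²(M)`. -/
def modeLin (n : ℤ) : L2M →ₗ[ℂ] L2SM where
  toFun p := (memLp_mode n p).toLp _
  map_add' p q := by
    rw [← MemLp.toLp_add]
    refine MemLp.toLp_congr _ _ ?_
    filter_upwards [ae_fst (Lp.coeFn_add p q)] with s hs
    simp only [hs, Pi.add_apply]
    ring
  map_smul' c p := by
    rw [RingHom.id_apply, ← MemLp.toLp_const_smul]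
    refine MemLp.toLp_congr _ _ ?_
    filter_upwards [ae_fst (Lp.coeFn_smul c p)] with s hs
    simp only [hs, Pi.smul_apply, smul_eq_mul]
    ring

lemma coeFn_modeLin (n : ℤ) (p : L2M) :
    modeLin n p =ᵐ[volSM] fun s => p s.1 * fourier n s.2 :=
  (memLp_mode n p).coeFn_toLp

lemma integral_conj_fourier_mul (n k : ℤ) :
    ∫ θ : Circ, conj (fourier n θ) * fourier k θ = if n = k then 2 * (Real.pi : ℂ) else 0 := by
  have h := (orthonormal_iff_ite.1 (orthonormal_fourier (T := 2 * Real.pi))) n k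
  have h1 : ⟪(fourierLp 2 n : Lp ℂ 2 (@AddCircle.haarAddCircle (2 * Real.pi) _)),
      fourierLp 2 k⟫_ℂ = ∫ θ : Circ, conj (fourier n θ) * fourier k θ ∂AddCircle.haarAddCircle := by
    rw [L2.inner_def]
    refine integral_congr_ae ?_
    filter_upwards [coeFn_fourierLp (T := 2 * Real.pi) 2 n, coeFn_fourierLp (T := 2 * Real.pi) 2 k]
      with θ h1 h2
    rw [h1, h2, RCLike.inner_apply, mul_comm]
  rw [AddCircle.volume_eq_smul_haarAddCircle, integral_smul_measure, ← h1, h]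
  split_ifs
  · simp [Real.pi_pos.le, ENNReal.toReal_ofReal]
  · simp

lemma inner_modeLin (n k : ℤ) (p q : L2M) :
    ⟪modeLin n p, modeLin k q⟫_ℂ = (if n = k then 2 * (Real.pi : ℂ) else 0) * ⟪p, q⟫_ℂ := by
  have h1 : ⟪modeLin n p, modeLin k q⟫_ℂ = ∫ s : ℂ × Circ,
      (q s.1 * conj (p s.1)) * (conj (fourier n s.2) * fourier k s.2) ∂(volM.prod volume) := by
    rw [L2.inner_def]
    refine integral_congr_ae ?_
    filter_upwards [coeFn_modeLin n p, coeFn_modeLin k q] with s h1 h2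
    rw [h1, h2, RCLike.inner_apply, map_mul]
    ring
  rw [h1, integral_prod_mul (fun z => q z * conj (p z))
    (fun θ : Circ => conj (fourier n θ) * fourier k θ), integral_conj_fourier_mul, mul_comm,
    L2.inner_def]
  simp only [RCLike.inner_apply]

lemma norm_modeLin_sq (n : ℤ) (p : L2M) : ‖modeLin n p‖ ^ 2 = 2 * Real.pi * ‖p‖ ^ 2 := by
  have h := inner_modeLin n n p p
  rw [inner_self_eq_norm_sq_to_K, inner_self_eq_norm_sq_to_K, if_pos rfl] at h
  have h' : ((‖modeLin n p‖ ^ 2 : ℝ) : ℂ) = ((2 * Real.pi * ‖p‖ ^ 2 : ℝ) : ℂ) := by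
    push_cast; exact h
  exact_mod_cast h'

/-- The continuous linear map `p ↦ p(x) e^{inθ}` from `L²(M)` to `L²(SM)`. -/
def mode (n : ℤ) : L2M →L[ℂ] L2SM :=
  (modeLin n).mkContinuous (Real.sqrt (2 * Real.pi)) fun p => by
    rw [← Real.sqrt_sq (norm_nonneg (modeLin n p)), norm_modeLin_sq,
      Real.sqrt_mul Real.two_pi_pos.le, Real.sqrt_sq (norm_nonneg p)]

lemma coeFn_mode (n : ℤ) (p : L2M) :
    mode n p =ᵐ[volSM] fun s => p s.1 * fourier n s.2 := coeFn_modeLin n p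

lemma inner_mode (n k : ℤ) (p q : L2M) :
    ⟪mode n p, mode k q⟫_ℂ = (if n = k then 2 * (Real.pi : ℂ) else 0) * ⟪p, q⟫_ℂ :=
  inner_modeLin n k p q

/-- The `n`-th Fourier coefficient in the angle `θ`, as a map from `L²(SM)` to `L²(M)`. -/
def coeff (n : ℤ) : L2SM →L[ℂ] L2M :=
  (2 * (Real.pi : ℂ))⁻¹ • ContinuousLinearMap.adjoint (mode n)

lemma coeff_mode (n k : ℤ) (p : L2M) : coeff n (mode k p) = if n = k then p else 0 := by
  refine ext_inner_left ℂ fun q => ?_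
  have hpi : (2 * (Real.pi : ℂ)) ≠ 0 := by simp [Real.pi_ne_zero]
  rw [coeff, _root_.smul_apply, inner_smul_right,
    ContinuousLinearMap.adjoint_inner_right, inner_mode]
  split_ifs
  · field_simp
  · simp

@[simp] lemma coeff_mode_self (n : ℤ) (p : L2M) : coeff n (mode n p) = p := by simp [coeff_mode]

lemma coeff_mode_of_ne {n k : ℤ} (h : n ≠ k) (p : L2M) : coeff n (mode k p) = 0 := by
  simp [coeff_mode, h]

lemma mode_mem_H {n : ℤ} {k : ℕ} (h : n.natAbs = k) (p : L2M) : mode n p ∈ H k := by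
  have h0 := ae_fst (Lp.coeFn_zero ℂ 2 volM)
  rcases Int.natAbs_eq n with hn | hn
  · refine ⟨p, 0, ?_⟩
    filter_upwards [coeFn_mode n p, h0] with s h1 h2
    rw [h1, harmonicFun, h2, hn, h]; simp
  · refine ⟨0, p, ?_⟩
    filter_upwards [coeFn_mode n p, h0] with s h1 h2
    rw [h1, harmonicFun, h2, hn, h]; simp

lemma harmonicFun_ae_eq_mode_add (k : ℕ) (p q : L2M) :
    ((mode k p + mode (-k) q : L2SM) : ℂ × Circ → ℂ) =ᵐ[volSM] harmonicFun k p q := by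
  filter_upwards [coeFn_mode k p, coeFn_mode (-k) q, Lp.coeFn_add (mode k p) (mode (-k) q)]
    with s h1 h2 h3
  rw [h3, Pi.add_apply, h1, h2, harmonicFun]

lemma mem_H_iff {k : ℕ} {u : L2SM} : u ∈ H k ↔ ∃ p q : L2M, u = mode k p + mode (-k) q := by
  constructor
  · rintro ⟨p, q, h⟩
    exact ⟨p, q, Lp.ext (h.trans (harmonicFun_ae_eq_mode_add k p q).symm)⟩
  · rintro ⟨p, q, rfl⟩
    exact ⟨p, q, harmonicFun_ae_eq_mode_add k p q⟩

/-- The squared norm of the component of order `k` of a function on `SM`, in terms of its Fourier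
coefficients; for `k = 0` there is only one coefficient. -/
def energy (k : ℕ) (f : L2SM) : ℝ :=
  2 * Real.pi * (‖coeff k f‖ ^ 2 + if k = 0 then 0 else ‖coeff (-k) f‖ ^ 2)

lemma energy_nonneg (k : ℕ) (f : L2SM) : 0 ≤ energy k f := by
  unfold energy; have := Real.pi_pos; split_ifs <;> positivity

lemma norm_mode_sq (n : ℤ) (p : L2M) : ‖mode n p‖ ^ 2 = 2 * Real.pi * ‖p‖ ^ 2 :=
  norm_modeLin_sq n p

lemma norm_sq_of_mem_H {k : ℕ} {f : L2SM} (hf : f ∈ H k) : ‖f‖ ^ 2 = energy k f := by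
  obtain ⟨p, q, rfl⟩ := mem_H_iff.1 hf
  rcases Nat.eq_zero_or_pos k with rfl | hk
  · have h : mode ((0 : ℕ) : ℤ) p + mode (-((0 : ℕ) : ℤ)) q = mode 0 (p + q) := by simp
    rw [h, energy, norm_mode_sq]
    simp
  · have h1 : (k : ℤ) ≠ -k := by omega
    have h0 : ⟪mode k p, mode (-k) q⟫_ℂ = 0 := by rw [inner_mode, if_neg h1, zero_mul]
    have h2 := norm_add_sq_eq_norm_sq_add_norm_sq_of_inner_eq_zero _ _ h0
    rw [energy, if_neg hk.ne', map_add, map_add, coeff_mode_self, coeff_mode_self,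
      coeff_mode_of_ne h1, coeff_mode_of_ne h1.symm, add_zero, zero_add, sq, h2, ← sq, ← sq,
      norm_mode_sq, norm_mode_sq]
    ring

lemma coeff_of_mem_H {k : ℕ} {f : L2SM} (hf : f ∈ H k) {n : ℤ} (hn : n.natAbs ≠ k) :
    coeff n f = 0 := by
  obtain ⟨p, q, rfl⟩ := mem_H_iff.1 hf
  rw [map_add, coeff_mode_of_ne (by omega), coeff_mode_of_ne (by omega), add_zero]

lemma H_le_L2Deg {k m : ℕ} (h : k ≤ m) : H k ≤ L2Deg m :=
  le_iSup₂_of_le k (Finset.mem_range.2 (by omega)) le_rfl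

lemma mode_mem_L2Deg {n : ℤ} {m : ℕ} (h : n.natAbs ≤ m) (p : L2M) : mode n p ∈ L2Deg m :=
  H_le_L2Deg h (mode_mem_H rfl p)

lemma exists_sum_of_mem_L2Deg {m : ℕ} {f : L2SM} (hf : f ∈ L2Deg m) :
    ∃ fk : ℕ → L2SM, (∀ k ∈ Finset.range (m + 1), fk k ∈ H k) ∧
      f = ∑ k ∈ Finset.range (m + 1), fk k := by
  obtain ⟨g, hg⟩ := (Submodule.mem_iSup_finset_iff_exists_sum _ _).1 hf
  exact ⟨fun k => g k, fun k _ => (g k).2, hg.symm⟩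

lemma coeff_sum_eq {m : ℕ} {fk : ℕ → L2SM} (hk : ∀ k ∈ Finset.range (m + 1), fk k ∈ H k)
    {n : ℤ} {k : ℕ} (hn : n.natAbs = k) (hkm : k ≤ m) :
    coeff n (∑ k ∈ Finset.range (m + 1), fk k) = coeff n (fk k) := by
  rw [map_sum]
  refine Finset.sum_eq_single k (fun j hj hjk => coeff_of_mem_H (hk j hj) (by omega)) ?_
  intro h; exact absurd (Finset.mem_range.2 (by omega)) h

lemma energy_sum_eq {m : ℕ} {fk : ℕ → L2SM} (hk : ∀ k ∈ Finset.range (m + 1), fk k ∈ H k)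
    {k : ℕ} (hkm : k ≤ m) :
    energy k (∑ k ∈ Finset.range (m + 1), fk k) = ‖fk k‖ ^ 2 := by
  rw [norm_sq_of_mem_H (hk k (Finset.mem_range.2 (by omega))), energy, energy,
    coeff_sum_eq hk (by simp) hkm, coeff_sum_eq hk (by simp) hkm]

lemma eq_of_coeff_eq {m : ℕ} {f : L2SM} (hf : f ∈ L2Deg m) :
    f = mode 0 (coeff 0 f) +
      ∑ k ∈ Finset.Icc 1 m, (mode k (coeff k f) + mode (-k) (coeff (-k) f)) := by
  obtain ⟨fk, hk, rfl⟩ := exists_sum_of_mem_L2Deg hf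
  have h0 : Finset.range (m + 1) = insert 0 (Finset.Icc 1 m) := by
    ext j; simp only [Finset.mem_range, Finset.mem_insert, Finset.mem_Icc]; omega
  nth_rewrite 1 [h0]
  rw [Finset.sum_insert (by simp)]
  congr 1
  · rw [coeff_sum_eq hk (k := 0) (by simp) (by omega)]
    obtain ⟨p, q, h⟩ := mem_H_iff.1 (hk 0 (by simp))
    rw [h]; simp
  · refine Finset.sum_congr rfl fun k hkm => ?_
    rw [Finset.mem_Icc] at hkm
    rw [coeff_sum_eq hk (k := k) (by simp) (by omega),
      coeff_sum_eq hk (k := k) (by simp) (by omega)]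
    obtain ⟨p, q, h⟩ := mem_H_iff.1 (hk k (by simp; omega))
    have h1 : (k : ℤ) ≠ -k := by omega
    rw [h, map_add (coeff k), map_add (coeff (-k)), coeff_mode_self, coeff_mode_self,
      coeff_mode_of_ne h1, coeff_mode_of_ne h1.symm, add_zero, zero_add]

lemma norm_sq_eq_sum_energy {m : ℕ} {f : L2SM} (hf : f ∈ L2Deg m) :
    ‖f‖ ^ 2 = ∑ k ∈ Finset.range (m + 1), energy k f := by
  obtain ⟨fk, hk, rfl⟩ := exists_sum_of_mem_L2Deg hf
  have horth : ∀ i ∈ Finset.range (m + 1), ∀ j ∈ Finset.range (m + 1), i ≠ j →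
      ⟪fk i, fk j⟫_ℂ = 0 := by
    intro i hi j hj hij
    obtain ⟨p, q, h⟩ := mem_H_iff.1 (hk i hi)
    obtain ⟨p', q', h'⟩ := mem_H_iff.1 (hk j hj)
    rw [h, h']
    simp only [inner_add_left, inner_add_right, inner_mode]
    rw [if_neg (by omega), if_neg (by omega), if_neg (by omega), if_neg (by omega)]
    simp
  have h1 : ∀ k ∈ Finset.range (m + 1), energy k (∑ k ∈ Finset.range (m + 1), fk k)
      = ‖fk k‖ ^ 2 := fun k hkm => energy_sum_eq hk (by have := Finset.mem_range.1 hkm; omega)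
  rw [Finset.sum_congr rfl h1]
  have h2 : ((‖∑ k ∈ Finset.range (m + 1), fk k‖ ^ 2 : ℝ) : ℂ)
      = ((∑ k ∈ Finset.range (m + 1), ‖fk k‖ ^ 2 : ℝ) : ℂ) := by
    push_cast
    rw [← Complex.coe_algebraMap, ← inner_self_eq_norm_sq_to_K, sum_inner]
    refine Finset.sum_congr rfl fun i hi => ?_
    rw [inner_sum, Finset.sum_eq_single i (fun j hj hji => horth i hi j hj hji.symm)
      (fun h => absurd hi h)]
    rw [inner_self_eq_norm_sq_to_K]
  exact_mod_cast h2

/-! ### The attenuated X-ray transform on `L²(SM)` -/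

lemma dir_add (x y : Circ) : dir (x + y) = dir x * dir y := by
  simp [dir, AddCircle.toCircle_add]

lemma dir_coe (x : ℝ) : dir (x : Circ) = Complex.exp (x * I) := by
  have h : 2 * Real.pi / (2 * Real.pi) * x = x := by field_simp
  rw [dir, AddCircle.toCircle_apply_mk, h, Circle.coe_exp]

lemma norm_dir (x : Circ) : ‖dir x‖ = 1 := Circle.norm_coe _

lemma continuous_dir : Continuous dir :=
  continuous_subtype_val.comp AddCircle.continuous_toCircle

lemma continuous_fanAngle : Continuous fanAngle := by
  unfold fanAngle
  exact continuous_fst.add ((AddCircle.continuous_mk' _).comp (by fun_prop))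

lemma continuous_geod : Continuous fun x : (Circ × ℝ) × ℝ => geod x.1 x.2 := by
  unfold geod
  have h1 := continuous_dir
  have h2 := continuous_fanAngle
  fun_prop

lemma dir_pi_add (x : ℝ) : dir ((Real.pi + x : ℝ) : Circ) = -Complex.exp (x * I) := by
  rw [dir_coe]
  push_cast
  rw [add_mul, Complex.exp_add, Complex.exp_pi_mul_I, neg_one_mul]

lemma geod_eq (b : Circ × ℝ) (t : ℝ) :
    geod b t = dir (fanAngle b) * ((t - Real.cos b.2 : ℝ) + (Real.sin b.2 : ℝ) * I) := by
  have h : dir (fanAngle b) * (-Complex.exp (-(b.2 * I))) = dir b.1 := by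
    rw [fanAngle, dir_add, dir_pi_add, mul_assoc, neg_mul_neg, ← Complex.exp_add,
      add_neg_cancel, Complex.exp_zero, mul_one]
  rw [geod, ← h, ← neg_mul, Complex.exp_mul_I]
  push_cast
  rw [Complex.cos_neg, Complex.sin_neg]
  ring

lemma norm_geod_sq (b : Circ × ℝ) (t : ℝ) :
    ‖geod b t‖ ^ 2 = (t - Real.cos b.2) ^ 2 + Real.sin b.2 ^ 2 := by
  rw [geod_eq, norm_mul, norm_dir, one_mul, ← Complex.normSq_eq_norm_sq, Complex.normSq_add_mul_I]

lemma norm_geod_zero (b : Circ × ℝ) : ‖geod b 0‖ = 1 := by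
  have h := norm_geod_sq b 0
  have h2 := Real.sin_sq_add_cos_sq b.2
  have h3 : ‖geod b 0‖ ^ 2 = 1 := by rw [h]; linarith
  exact (pow_eq_one_iff_of_nonneg (norm_nonneg _) two_ne_zero).1 h3

lemma norm_geod_exit (b : Circ × ℝ) : ‖geod b (2 * Real.cos b.2)‖ = 1 := by
  have h := norm_geod_sq b (2 * Real.cos b.2)
  have h2 := Real.sin_sq_add_cos_sq b.2
  have h3 : ‖geod b (2 * Real.cos b.2)‖ ^ 2 = 1 := by rw [h]; linarith
  exact (pow_eq_one_iff_of_nonneg (norm_nonneg _) two_ne_zero).1 h3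

lemma geod_mem_disc {b : Circ × ℝ} {t : ℝ} (ht : t ∈ Set.Icc 0 (2 * Real.cos b.2)) :
    geod b t ∈ disc := by
  rw [disc, mem_closedBall_zero_iff]
  have h := norm_geod_sq b t
  have h2 := Real.sin_sq_add_cos_sq b.2
  have h3 : t * (2 * Real.cos b.2 - t) ≥ 0 := mul_nonneg ht.1 (by linarith [ht.2])
  nlinarith [norm_nonneg (geod b t)]

lemma lintegral_rotate (θ : Circ) (F : ℂ → ENNReal) :
    ∫⁻ z in disc, F (dir θ * z) = ∫⁻ z in disc, F z := by
  have h := (LinearIsometryEquiv.measurePreserving (rotation (AddCircle.toCircle θ)))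
  have h2 : (rotation (AddCircle.toCircle θ)) ⁻¹' disc = disc := by
    ext z
    rw [Set.mem_preimage, disc, mem_closedBall_zero_iff, mem_closedBall_zero_iff,
      LinearIsometryEquiv.norm_map]
  have h3 := h.setLIntegral_comp_preimage_emb
    (rotation (AddCircle.toCircle θ)).toHomeomorph.measurableEmbedding F disc
  rw [h2] at h3
  exact h3

/-- Substituting `y = sin α`, `x = t - cos α` turns the integral over
the chords of a fixed direction into an area integral over the disc. -/
lemma lintegral_chords_le (F : ℂ → ENNReal) (hF : Measurable F) :
    ∫⁻ α in Set.Icc (-(Real.pi / 2)) (Real.pi / 2), ENNReal.ofReal (Real.cos α) *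
      ∫⁻ t in Set.Ioc 0 (2 * Real.cos α),
        F ((t - Real.cos α : ℝ) + (Real.sin α : ℝ) * I) ≤ ∫⁻ z in disc, F z := by
  set Φ : ℂ → ENNReal := disc.indicator F with hΦ
  have hΦm : Measurable Φ := hF.indicator measurableSet_disc
  have h1 : ∀ α, ∫⁻ t in Set.Ioc 0 (2 * Real.cos α),
        F ((t - Real.cos α : ℝ) + (Real.sin α : ℝ) * I) ≤
        ∫⁻ x : ℝ, Φ (x + (Real.sin α : ℝ) * I) := by
    intro α
    rw [← lintegral_sub_right_eq_self (μ := volume)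
      (fun x : ℝ => Φ (x + (Real.sin α : ℝ) * I)) (Real.cos α)]
    refine le_trans (setLIntegral_mono_ae' measurableSet_Ioc (Eventually.of_forall fun t ht => ?_))
      (setLIntegral_le_lintegral (Set.Ioc 0 (2 * Real.cos α)) _)
    rw [hΦ, Set.indicator_of_mem]
    rw [disc, mem_closedBall_zero_iff]
    have h := Complex.normSq_add_mul_I (t - Real.cos α) (Real.sin α)
    rw [Complex.normSq_eq_norm_sq] at h
    have h2 := Real.sin_sq_add_cos_sq α
    have h3 : t * (2 * Real.cos α - t) ≥ 0 := mul_nonneg ht.1.le (by linarith [ht.2])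
    nlinarith [norm_nonneg (((t - Real.cos α : ℝ) : ℂ) + (Real.sin α : ℝ) * I)]
  have h2 : ∫⁻ α in Set.Icc (-(Real.pi / 2)) (Real.pi / 2), ENNReal.ofReal (Real.cos α) *
      ∫⁻ x : ℝ, Φ (x + (Real.sin α : ℝ) * I) ≤ ∫⁻ y : ℝ, ∫⁻ x : ℝ, Φ (x + y * I) := by
    refine le_trans (le_of_eq ?_) (setLIntegral_le_lintegral
      (Real.sin '' Set.Icc (-(Real.pi / 2)) (Real.pi / 2)) _)
    rw [lintegral_image_eq_lintegral_abs_deriv_mul measurableSet_Icc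
      (fun x _ => (Real.hasDerivAt_sin x).hasDerivWithinAt) Real.injOn_sin]
    refine setLIntegral_congr_fun measurableSet_Icc fun α hα => ?_
    rw [abs_of_nonneg (Real.cos_nonneg_of_mem_Icc hα)]
  refine le_trans (lintegral_mono fun α => mul_le_mul_right (h1 α) _) (h2.trans (le_of_eq ?_))
  rw [← lintegral_indicator measurableSet_disc,
    ← (Complex.volume_preserving_equiv_real_prod.symm).lintegral_comp hΦm,
    Measure.volume_eq_prod, lintegral_prod_symm]
  · refine lintegral_congr fun y => lintegral_congr fun x => ?_
    simp [Complex.measurableEquivRealProd_symm_apply, Complex.mk_eq_add_mul_I]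
  · exact (hΦm.comp (MeasurableEquiv.measurable _)).aemeasurable

/-- The inequality in Santaló's formula. It controls both null sets and `L¹` norms along the
geodesics. -/
lemma santalo_le (F : ℂ × Circ → ENNReal) (hF : Measurable F) :
    ∫⁻ b, ENNReal.ofReal (Real.cos b.2) *
      (∫⁻ t in Set.Ioc 0 (2 * Real.cos b.2), F (geod b t, fanAngle b)) ∂volBdry ≤
      ∫⁻ s, F s ∂volSM := by
  set J : Circ → ℝ → ENNReal := fun θ α => ∫⁻ t in Set.Ioc 0 (2 * Real.cos α),
        F (dir θ * ((t - Real.cos α : ℝ) + (Real.sin α : ℝ) * I), θ) with hJ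
  have hd := continuous_dir
  have hJm : Measurable fun x : Circ × ℝ => J x.1 x.2 := by
    have hset : MeasurableSet {x : (Circ × ℝ) × ℝ | 0 < x.2 ∧ x.2 ≤ 2 * Real.cos x.1.2} :=
      (measurableSet_lt measurable_const measurable_snd).inter
        (measurableSet_le measurable_snd (by fun_prop))
    have hm : Measurable fun x : (Circ × ℝ) × ℝ =>
        F (dir x.1.1 * ((x.2 - Real.cos x.1.2 : ℝ) + (Real.sin x.1.2 : ℝ) * I), x.1.1) :=
      hF.comp (Continuous.measurable (by fun_prop))
    have h := (hm.indicator hset).lintegral_prod_right' (ν := volume)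
    convert h using 2 with x
    rw [hJ]
    simp only
    rw [← lintegral_indicator measurableSet_Ioc]
    rfl
  have hGm : Measurable fun x : Circ × ℝ => ENNReal.ofReal (Real.cos x.2) * J x.1 x.2 :=
    Measurable.mul (by fun_prop) hJm
  calc ∫⁻ b, ENNReal.ofReal (Real.cos b.2) *
        (∫⁻ t in Set.Ioc 0 (2 * Real.cos b.2), F (geod b t, fanAngle b)) ∂volBdry
      = ∫⁻ b, ENNReal.ofReal (Real.cos b.2) * J (fanAngle b) b.2 ∂volBdry := by
        simp only [geod_eq, hJ]
    _ = ∫⁻ α in Set.Icc (-(Real.pi / 2)) (Real.pi / 2), ∫⁻ β : Circ,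
          ENNReal.ofReal (Real.cos α) * J (fanAngle (β, α)) α := by
        rw [volBdry, lintegral_prod_symm]
        exact (hGm.comp (continuous_fanAngle.measurable.prodMk measurable_snd)).aemeasurable
    _ = ∫⁻ α in Set.Icc (-(Real.pi / 2)) (Real.pi / 2), ∫⁻ θ : Circ,
          ENNReal.ofReal (Real.cos α) * J θ α := by
        refine lintegral_congr fun α => ?_
        exact lintegral_add_right_eq_self (μ := (volume : Measure Circ))
          (fun θ => ENNReal.ofReal (Real.cos α) * J θ α) ((Real.pi + α : ℝ) : Circ)
    _ = ∫⁻ θ : Circ, ∫⁻ α in Set.Icc (-(Real.pi / 2)) (Real.pi / 2),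
          ENNReal.ofReal (Real.cos α) * J θ α :=
        lintegral_lintegral_swap (hGm.comp measurable_swap).aemeasurable
    _ ≤ ∫⁻ θ : Circ, ∫⁻ z in disc, F (dir θ * z, θ) :=
        lintegral_mono fun θ => lintegral_chords_le (fun z => F (dir θ * z, θ))
          (hF.comp (Continuous.measurable (by fun_prop)))
    _ = ∫⁻ θ : Circ, ∫⁻ z in disc, F (z, θ) :=
        lintegral_congr fun θ => lintegral_rotate θ (fun z => F (z, θ))
    _ = ∫⁻ s, F s ∂volSM := by
        rw [volSM, lintegral_prod_symm _ hF.aemeasurable]; rfl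

lemma measurable_chord_lintegral (F : ℂ × Circ → ENNReal) (hF : Measurable F) :
    Measurable fun b : Circ × ℝ =>
      ∫⁻ t in Set.Ioc 0 (2 * Real.cos b.2), F (geod b t, fanAngle b) := by
  have hset : MeasurableSet {x : (Circ × ℝ) × ℝ | 0 < x.2 ∧ x.2 ≤ 2 * Real.cos x.1.2} :=
    (measurableSet_lt measurable_const measurable_snd).inter
      (measurableSet_le measurable_snd (by fun_prop))
  have hm : Measurable fun x : (Circ × ℝ) × ℝ => F (geod x.1 x.2, fanAngle x.1) :=
    hF.comp (continuous_geod.measurable.prodMk (continuous_fanAngle.comp continuous_fst).measurable)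
  have h := (hm.indicator hset).lintegral_prod_right' (ν := volume)
  convert h using 2 with b
  rw [← lintegral_indicator measurableSet_Ioc]
  rfl

lemma measurable_cos_snd : Measurable fun b : Circ × ℝ => ENNReal.ofReal (Real.cos b.2) := by
  fun_prop

lemma ae_cos_pos : ∀ᵐ b ∂volBdry, 0 < Real.cos b.2 := by
  have h : ∀ᵐ α ∂(volume.restrict (Set.Icc (-(Real.pi / 2)) (Real.pi / 2))), 0 < Real.cos α := by
    rw [← Measure.restrict_congr_set (Ioo_ae_eq_Icc (μ := volume))]
    filter_upwards [ae_restrict_mem measurableSet_Ioo] with α hα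
    exact Real.cos_pos_of_mem_Ioo hα
  exact Measure.quasiMeasurePreserving_snd.ae h

/-- If `∫_SM F` is finite, then so are almost all integrals of `F` along geodesics. -/
lemma ae_chord_lintegral_lt_top {F : ℂ × Circ → ENNReal} (hF : Measurable F)
    (h : ∫⁻ s, F s ∂volSM ≠ ⊤) :
    ∀ᵐ b ∂volBdry, ∫⁻ t in Set.Ioc 0 (2 * Real.cos b.2), F (geod b t, fanAngle b) < ⊤ := by
  have h1 := ae_lt_top (measurable_cos_snd.mul (measurable_chord_lintegral F hF))
    (ne_top_of_le_ne_top h (santalo_le F hF))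
  filter_upwards [h1, ae_cos_pos] with b hb hc
  by_contra hcon
  rw [not_lt, top_le_iff] at hcon
  rw [Pi.mul_apply, hcon, ENNReal.mul_top (by simpa using hc)] at hb
  exact lt_irrefl _ hb

/-- A family of functions with arbitrarily small integrals over `SM` has integrals along almost
every geodesic with infimum zero. -/
lemma ae_iInf_chord_lintegral_eq_zero {F : ℕ → ℂ × Circ → ENNReal} (hF : ∀ n, Measurable (F n))
    (h : Tendsto (fun n => ∫⁻ s, F n s ∂volSM) atTop (𝓝 0)) :
    ∀ᵐ b ∂volBdry,
      ⨅ n, ∫⁻ t in Set.Ioc 0 (2 * Real.cos b.2), F n (geod b t, fanAngle b) = 0 := by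
  set h' : Circ × ℝ → ENNReal := fun b =>
    ⨅ n, ∫⁻ t in Set.Ioc 0 (2 * Real.cos b.2), F n (geod b t, fanAngle b) with hh'
  have hm : Measurable h' := Measurable.iInf fun n => measurable_chord_lintegral (F n) (hF n)
  have h1 : ∫⁻ b, ENNReal.ofReal (Real.cos b.2) * h' b ∂volBdry = 0 := by
    refine le_antisymm (ge_of_tendsto' h fun n => ?_) bot_le
    exact le_trans (lintegral_mono fun b => mul_le_mul_right (iInf_le _ n) _)
      (santalo_le (F n) (hF n))
  replace h1 := (lintegral_eq_zero_iff (measurable_cos_snd.mul hm)).1 h1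
  filter_upwards [h1, ae_cos_pos] with b hb hc
  rcases mul_eq_zero.1 hb with h0 | h0
  · exact absurd (ENNReal.ofReal_eq_zero.1 h0) (not_le.2 hc)
  · exact h0

lemma ae_chord_lintegral_eq_zero {F : ℂ × Circ → ENNReal} (hF : Measurable F)
    (h : ∫⁻ s, F s ∂volSM = 0) :
    ∀ᵐ b ∂volBdry, ∫⁻ t in Set.Ioc 0 (2 * Real.cos b.2), F (geod b t, fanAngle b) = 0 := by
  have h1 := ae_iInf_chord_lintegral_eq_zero (F := fun _ => F) (fun _ => hF) (by simp [h])
  simpa using h1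

/-- A property that holds almost everywhere on `SM` holds almost everywhere along almost every
geodesic. -/
lemma ae_ae_geod {P : ℂ × Circ → Prop} (h : ∀ᵐ s ∂volSM, P s) :
    ∀ᵐ b ∂volBdry, ∀ᵐ t ∂(volume.restrict (Set.Ioc 0 (2 * Real.cos b.2))),
      P (geod b t, fanAngle b) := by
  obtain ⟨N, hN, hNm, hN0⟩ := exists_measurable_superset_of_null (ae_iff.1 h)
  have h1 := ae_chord_lintegral_eq_zero (F := N.indicator 1) (measurable_one.indicator hNm)
    (by rw [lintegral_indicator_one hNm, hN0])
  filter_upwards [h1] with b hb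
  have hm : Measurable fun t : ℝ => N.indicator (1 : ℂ × Circ → ENNReal) (geod b t, fanAngle b) :=
    (measurable_one.indicator hNm).comp
      ((continuous_geod.comp (by fun_prop : Continuous fun t : ℝ => (b, t))).measurable.prodMk
        measurable_const)
  rw [lintegral_eq_zero_iff hm] at hb
  filter_upwards [hb] with t ht
  by_contra hP
  have : (geod b t, fanAngle b) ∈ N := hN hP
  simp [this] at ht

lemma lintegral_enorm_ne_top (f : L2SM) : ∫⁻ s, ‖f s‖ₑ ∂volSM ≠ ⊤ :=
  ((Lp.memLp f).integrable (by norm_num)).2.ne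

/-- The restriction of a function in `L²(SM)` to almost every geodesic is integrable. -/
lemma ae_integrableOn_geod (f : L2SM) :
    ∀ᵐ b ∂volBdry, IntegrableOn (fun t => f (geod b t, fanAngle b))
      (Set.Ioc 0 (2 * Real.cos b.2)) := by
  have hm := (Lp.stronglyMeasurable f).measurable
  filter_upwards [ae_chord_lintegral_lt_top hm.enorm (lintegral_enorm_ne_top f)] with b hb
  refine ⟨?_, hb⟩
  exact (hm.comp
      ((continuous_geod.comp (by fun_prop : Continuous fun t : ℝ => (b, t))).measurable.prodMk
        measurable_const)).aestronglyMeasurable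

lemma attXray_congr_ae (a : ℂ → ℂ) {f g : ℂ × Circ → ℂ} (h : f =ᵐ[volSM] g) :
    attXray a f =ᵐ[volBdry] attXray a g := by
  filter_upwards [ae_ae_geod h, ae_cos_pos] with b hb hc
  rw [attXray, attXray, intervalIntegral.integral_of_le (by linarith),
    intervalIntegral.integral_of_le (by linarith)]
  refine integral_congr_ae ?_
  filter_upwards [hb] with t ht
  rw [ht]

/-- The attenuation along the geodesic with fan-beam coordinates `b`. -/
def weight (a : ℂ → ℂ) (b : Circ × ℝ) (t : ℝ) : ℂ := Complex.exp (∫ s in (0 : ℝ)..t, a (geod b s))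

lemma attXray_eq_setIntegral (a : ℂ → ℂ) (f : ℂ × Circ → ℂ) :
    ∀ᵐ b ∂volBdry, attXray a f b =
      ∫ t in Set.Ioc 0 (2 * Real.cos b.2), f (geod b t, fanAngle b) * weight a b t := by
  filter_upwards [ae_cos_pos] with b hc
  rw [attXray, intervalIntegral.integral_of_le (by linarith)]
  rfl

lemma attXray_smul (a : ℂ → ℂ) (c : ℂ) (f : L2SM) : attXray a (c • f : L2SM) =ᵐ[volBdry]
    fun b => c * attXray a f b := by
  filter_upwards [attXray_congr_ae a (Lp.coeFn_smul c f), attXray_eq_setIntegral a f,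
    attXray_eq_setIntegral a (c • ⇑f)] with b h1 h2 h3
  rw [h1, h2, h3, ← integral_const_mul]
  simp only [Pi.smul_apply, smul_eq_mul, mul_assoc]

section attenuated

variable {a : ℂ → ℂ} (ha : ContinuousOn a disc)

include ha

lemma continuousOn_comp_geod (b : Circ × ℝ) :
    ContinuousOn (fun t => a (geod b t)) (Set.Icc 0 (2 * Real.cos b.2)) :=
  ha.comp (continuous_geod.comp (by fun_prop : Continuous fun t : ℝ => (b, t))).continuousOn
    fun _ ht => geod_mem_disc ht

lemma continuousOn_weight (b : Circ × ℝ) :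
    ContinuousOn (weight a b) (Set.Icc 0 (2 * Real.cos b.2)) := by
  rcases le_or_gt 0 (2 * Real.cos b.2) with hc | hc
  · refine Complex.continuous_exp.comp_continuousOn ?_
    have h := intervalIntegral.continuousOn_primitive_interval'
      ((continuousOn_comp_geod ha b).intervalIntegrable_of_Icc (μ := volume) hc)
      (Set.left_mem_uIcc)
    rwa [Set.uIcc_of_le hc] at h
  · rw [Set.Icc_eq_empty (not_le.2 hc)]; exact continuousOn_empty _

lemma norm_le_supM {z : ℂ} (hz : z ∈ disc) : ‖a z‖ ≤ supM a :=
  le_csSup (((isCompact_closedBall (0 : ℂ) 1).image_of_continuousOn ha.norm).bddAbove)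
    (Set.mem_image_of_mem _ hz)

lemma supM_nonneg : 0 ≤ supM a :=
  (norm_nonneg _).trans (norm_le_supM ha (z := 0) (by simp [disc]))

lemma norm_weight_le {b : Circ × ℝ} {t : ℝ} (ht : t ∈ Set.Icc 0 (2 * Real.cos b.2)) :
    ‖weight a b t‖ ≤ Real.exp (2 * supM a) := by
  rw [weight, Complex.norm_exp, Real.exp_le_exp]
  refine (Complex.re_le_norm _).trans ?_
  have h1 : ‖∫ s in (0 : ℝ)..t, a (geod b s)‖ ≤ supM a * |t - 0| :=
    intervalIntegral.norm_integral_le_of_norm_le_const fun s hs => by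
      rw [Set.uIoc_of_le ht.1] at hs
      exact norm_le_supM ha (geod_mem_disc ⟨hs.1.le, hs.2.trans ht.2⟩)
  have h2 : |t - 0| ≤ 2 := by
    rw [sub_zero, abs_of_nonneg ht.1]
    linarith [ht.2, Real.cos_le_one b.2]
  have := supM_nonneg ha
  nlinarith

lemma integrableOn_mul_weight {b : Circ × ℝ} {g : ℝ → ℂ}
    (hg : IntegrableOn g (Set.Ioc 0 (2 * Real.cos b.2))) :
    IntegrableOn (fun t => g t * weight a b t) (Set.Ioc 0 (2 * Real.cos b.2)) := by
  have h := (continuousOn_weight ha b).mono Set.Ioc_subset_Icc_self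
  refine Integrable.mul_bdd (c := Real.exp (2 * supM a)) hg
    (h.aestronglyMeasurable measurableSet_Ioc) ?_
  filter_upwards [ae_restrict_mem measurableSet_Ioc] with t ht
  exact norm_weight_le ha ⟨ht.1.le, ht.2⟩

lemma attXray_add (f g : L2SM) : attXray a (f + g : L2SM) =ᵐ[volBdry]
    fun b => attXray a f b + attXray a g b := by
  filter_upwards [attXray_congr_ae a (Lp.coeFn_add f g), attXray_eq_setIntegral a f,
    attXray_eq_setIntegral a g, attXray_eq_setIntegral a (⇑f + ⇑g), ae_integrableOn_geod f,
    ae_integrableOn_geod g] with b h1 h2 h3 h4 h5 h6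
  rw [h1, h2, h3, h4, ← integral_add (integrableOn_mul_weight ha h5)
    (integrableOn_mul_weight ha h6)]
  simp only [Pi.add_apply, add_mul]

lemma enorm_attXray_le (f : L2SM) : ∀ᵐ b ∂volBdry, ‖attXray a f b‖ₑ ≤
    ENNReal.ofReal (Real.exp (2 * supM a)) *
      ∫⁻ t in Set.Ioc 0 (2 * Real.cos b.2), ‖f (geod b t, fanAngle b)‖ₑ := by
  filter_upwards [attXray_eq_setIntegral a f] with b h1
  rw [h1, ← lintegral_const_mul' _ _ ENNReal.ofReal_ne_top]
  refine (enorm_integral_le_lintegral_enorm _).trans ?_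
  refine setLIntegral_mono_ae' measurableSet_Ioc (Eventually.of_forall fun t ht => ?_)
  rw [enorm_mul, mul_comm, ← ofReal_norm (weight a b t)]
  gcongr
  exact norm_weight_le ha ⟨ht.1.le, ht.2⟩

/-- The kernel of the attenuated X-ray transform in `L²(SM)`. -/
def xrayKer : Submodule ℂ L2SM where
  carrier := {f | attXray a f =ᵐ[volBdry] 0}
  zero_mem' := by
    have h := attXray_smul a 0 (0 : L2SM)
    rw [zero_smul] at h
    filter_upwards [h] with b hb
    rw [hb, zero_mul]; rfl
  add_mem' := by
    intro f g hf hg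
    rw [Set.mem_ofPred_eq] at *
    filter_upwards [attXray_add ha f g, hf, hg] with b h1 h2 h3
    rw [h1, h2, h3]; simp
  smul_mem' := by
    intro c f hf
    rw [Set.mem_ofPred_eq] at *
    filter_upwards [attXray_smul a c f, hf] with b h1 h2
    rw [h1, h2]; simp

lemma mem_xrayKer {f : L2SM} : f ∈ xrayKer ha ↔ attXray a f =ᵐ[volBdry] 0 := Iff.rfl

lemma attXray_eq_of_sub_mem {f g : L2SM} (h : f - g ∈ xrayKer ha) :
    attXray a f =ᵐ[volBdry] attXray a g := by
  have h1 := attXray_add ha (f - g) g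
  rw [sub_add_cancel] at h1
  filter_upwards [h1, (mem_xrayKer ha).1 h] with b hb h2
  rw [hb, h2]; simp

lemma isClosed_xrayKer : IsClosed (xrayKer ha : Set L2SM) := by
  refine IsSeqClosed.isClosed fun u f hu huf => ?_
  have hlim : Tendsto (fun n => ∫⁻ s, ‖(f - u n : L2SM) s‖ₑ ∂volSM) atTop (𝓝 0) := by
    have h0 : Tendsto (fun n => volSM Set.univ ^
        (1 / (1 : ENNReal).toReal - 1 / (2 : ENNReal).toReal) * ‖f - u n‖ₑ) atTop (𝓝 0) := by
      have h1 : Tendsto (fun n => ‖f - u n‖ₑ) atTop (𝓝 0) := by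
        have h2 : Tendsto (fun n => f - u n) atTop (𝓝 (f - f)) := tendsto_const_nhds.sub huf
        rw [sub_self] at h2
        simpa using h2.enorm
      have h3 := ENNReal.Tendsto.const_mul (a := volSM Set.univ ^
        (1 / (1 : ENNReal).toReal - 1 / (2 : ENNReal).toReal)) h1
        (Or.inr (ENNReal.rpow_ne_top_of_nonneg (by norm_num) (measure_ne_top _ _)))
      rwa [mul_zero] at h3
    refine tendsto_of_tendsto_of_tendsto_of_le_of_le tendsto_const_nhds h0 (fun _ => bot_le)
      fun n => ?_
    have h := eLpNorm_le_eLpNorm_mul_rpow_measure_univ (μ := volSM) (p := 1) (q := 2)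
      (by norm_num) (Lp.aestronglyMeasurable (f - u n))
    rw [eLpNorm_one_eq_lintegral_enorm, ← Lp.enorm_def] at h
    exact h.trans_eq (mul_comm _ _)
  have h1 := ae_iInf_chord_lintegral_eq_zero
    (fun n => (Lp.stronglyMeasurable (f - u n)).measurable.enorm) hlim
  have h2 : ∀ᵐ b ∂volBdry, ∀ n, ‖attXray a f b‖ₑ ≤ ENNReal.ofReal (Real.exp (2 * supM a)) *
      ∫⁻ t in Set.Ioc 0 (2 * Real.cos b.2), ‖(f - u n : L2SM) (geod b t, fanAngle b)‖ₑ := by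
    rw [ae_all_iff]
    intro n
    have h3 := attXray_add ha (f - u n) (u n)
    rw [sub_add_cancel] at h3
    filter_upwards [enorm_attXray_le ha (f - u n), h3, (mem_xrayKer ha).1 (hu n)] with b h4 h5 h6
    rw [h5, h6]; simpa using h4
  refine (mem_xrayKer ha).2 ?_
  filter_upwards [h1, h2] with b hb1 hb2
  have h3 := le_iInf hb2
  rw [← ENNReal.mul_iInf_of_ne (by simp [Real.exp_pos]) ENNReal.ofReal_ne_top, hb1, mul_zero] at h3
  simpa using h3

end attenuated

/-! ### The Sobolev space `H¹₀(M)` -/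

namespace IsTest

variable {φ ψ : ℂ → ℂ}

lemma differentiable (h : IsTest φ) : Differentiable ℝ φ := h.1.differentiable (by simp)

lemma zero : IsTest 0 :=
  ⟨contDiff_const, HasCompactSupport.zero, by simp [tsupport, Function.support_zero]⟩

lemma add (h : IsTest φ) (h' : IsTest ψ) : IsTest (φ + ψ) :=
  ⟨h.1.add h'.1, h.2.1.add h'.2.1,
    (tsupport_add φ ψ).trans (Set.union_subset h.2.2 h'.2.2)⟩

lemma const_smul (c : ℂ) (h : IsTest φ) : IsTest (c • φ) :=
  ⟨h.1.const_smul c, h.2.1.smul_left (f := fun _ => c),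
    (tsupport_smul_subset_right (fun _ => c) φ).trans h.2.2⟩

lemma star (h : IsTest φ) : IsTest fun z => conj (φ z) := by
  refine ⟨Complex.conjCLE.contDiff.comp h.1, h.2.1.comp_left (map_zero _), ?_⟩
  exact (closure_mono (Function.support_comp_subset (map_zero (starRingEnd ℂ)) φ)).trans h.2.2

lemma fderiv_apply (h : IsTest φ) (v : ℂ) : IsTest fun z => fderiv ℝ φ z v :=
  ⟨(h.1.fderiv_right (m := ∞) (by simp)).clm_apply contDiff_const, h.2.1.fderiv_apply ℝ v,
    (tsupport_fderiv_apply_subset ℝ v).trans h.2.2⟩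

lemma eq_zero (h : IsTest φ) {z : ℂ} (hz : 1 ≤ ‖z‖) : φ z = 0 := by
  by_contra hne
  have := h.2.2 (subset_tsupport φ hne)
  rw [mem_ball_zero_iff] at this
  linarith

lemma memLp (h : IsTest φ) : MemLp φ 2 volM :=
  h.1.continuous.memLp_of_hasCompactSupport h.2.1

/-- The class of a test function in `L²(M)`. -/
def toL2 (h : IsTest φ) : L2M := h.memLp.toLp φ

lemma coeFn_toL2 (h : IsTest φ) : h.toL2 =ᵐ[volM] φ := h.memLp.coeFn_toLp

lemma integral_volM (h : IsTest φ) (ψ : ℂ → ℂ) : ∫ z, ψ z * φ z ∂volM = ∫ z, ψ z * φ z := by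
  refine setIntegral_eq_integral_of_forall_compl_eq_zero fun z hz => ?_
  rw [disc, mem_closedBall_zero_iff, not_le] at hz
  rw [h.eq_zero hz.le, mul_zero]

lemma integral_mul_fderiv (h : IsTest φ) (h' : IsTest ψ) (v : ℂ) :
    ∫ z, φ z * fderiv ℝ ψ z v ∂volM = -∫ z, fderiv ℝ φ z v * ψ z ∂volM := by
  rw [(h'.fderiv_apply v).integral_volM φ, h'.integral_volM]
  refine integral_mul_fderiv_eq_neg_fderiv_mul_of_integrable ?_ ?_ ?_
    (fun x _ => h.differentiable x) (fun x _ => h'.differentiable x)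
  · exact ((h.fderiv_apply v).1.continuous.mul h'.1.continuous).integrable_of_hasCompactSupport
      h'.2.1.mul_left
  · exact (h.1.continuous.mul (h'.fderiv_apply v).1.continuous).integrable_of_hasCompactSupport
      h.2.1.mul_right
  · exact (h.1.continuous.mul h'.1.continuous).integrable_of_hasCompactSupport h.2.1.mul_right

lemma fderiv_star (h : IsTest φ) (z v : ℂ) :
    fderiv ℝ (fun z => conj (φ z)) z v = conj (fderiv ℝ φ z v) := by
  have h1 : HasFDerivAt (fun z => conj (φ z)) (Complex.conjCLE.toContinuousLinearMap.comp
      (fderiv ℝ φ z)) z :=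
    Complex.conjCLE.hasFDerivAt.comp z (h.differentiable z).hasFDerivAt
  rw [h1.fderiv]; rfl

lemma fderiv_fderiv_comm (h : IsTest φ) (v w z : ℂ) :
    fderiv ℝ (fun z => fderiv ℝ φ z v) z w = fderiv ℝ (fun z => fderiv ℝ φ z w) z v := by
  have hs : IsSymmSndFDerivAt ℝ φ z :=
    (h.1.of_le (m := 2) (WithTop.coe_le_coe.2 le_top)).contDiffAt.isSymmSndFDerivAt (by simp)
  have hd : DifferentiableAt ℝ (fderiv ℝ φ) z :=
    ((h.1.fderiv_right (m := ∞) (by simp)).differentiable (by simp)) z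
  have h1 : ∀ v w, fderiv ℝ (fun z => fderiv ℝ φ z v) z w = fderiv ℝ (fderiv ℝ φ) z w v := by
    intro v w
    rw [fderiv_clm_apply hd (differentiableAt_const v)]
    simp
  rw [h1, h1]
  exact hs.eq _ _

/-- The mixed products of first derivatives integrate symmetrically, by two integrations by
parts. -/
lemma integral_fderiv_mul_conj (h : IsTest φ) (v w : ℂ) :
    ∫ z, fderiv ℝ φ z v * conj (fderiv ℝ φ z w) ∂volM =
      ∫ z, fderiv ℝ φ z w * conj (fderiv ℝ φ z v) ∂volM := by
  simp only [← h.fderiv_star]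
  rw [(h.fderiv_apply v).integral_mul_fderiv h.star, (h.fderiv_apply w).integral_mul_fderiv h.star]
  simp only [h.fderiv_fderiv_comm v w]

end IsTest

lemma dx_add {φ ψ : ℂ → ℂ} (h : IsTest φ) (h' : IsTest ψ) : dx (φ + ψ) = dx φ + dx ψ := by
  ext z; simp [dx, fderiv_add (h.differentiable z) (h'.differentiable z)]

lemma dy_add {φ ψ : ℂ → ℂ} (h : IsTest φ) (h' : IsTest ψ) : dy (φ + ψ) = dy φ + dy ψ := by
  ext z; simp [dy, fderiv_add (h.differentiable z) (h'.differentiable z)]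

lemma dx_const_smul {φ : ℂ → ℂ} (h : IsTest φ) (c : ℂ) : dx (c • φ) = c • dx φ := by
  ext z; simp [dx, fderiv_const_smul (h.differentiable z) c]

lemma dy_const_smul {φ : ℂ → ℂ} (h : IsTest φ) (c : ℂ) : dy (c • φ) = c • dy φ := by
  ext z; simp [dy, fderiv_const_smul (h.differentiable z) c]

/-- `testGraph` as a submodule. -/
def testSub : Submodule ℂ (L2M × L2M × L2M) where
  carrier := testGraph
  zero_mem' := by
    have h0 := Lp.coeFn_zero ℂ 2 volM
    have h1 : dx 0 = 0 := by ext; simp [dx]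
    have h2 : dy 0 = 0 := by ext; simp [dy]
    exact ⟨0, IsTest.zero, h0, by rw [h1]; exact h0, by rw [h2]; exact h0⟩
  add_mem' := by
    rintro s t ⟨φ, h, h1, h2, h3⟩ ⟨ψ, h', h1', h2', h3'⟩
    refine ⟨φ + ψ, h.add h', (Lp.coeFn_add _ _).trans (h1.add h1'), ?_, ?_⟩
    · rw [dx_add h h']; exact (Lp.coeFn_add _ _).trans (h2.add h2')
    · rw [dy_add h h']; exact (Lp.coeFn_add _ _).trans (h3.add h3')
  smul_mem' := by
    rintro c t ⟨φ, h, h1, h2, h3⟩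
    refine ⟨c • φ, h.const_smul c, (Lp.coeFn_smul _ _).trans (h1.const_smul c), ?_, ?_⟩
    · rw [dx_const_smul h]; exact (Lp.coeFn_smul _ _).trans (h2.const_smul c)
    · rw [dy_const_smul h]; exact (Lp.coeFn_smul _ _).trans (h3.const_smul c)

/-- `H¹₀(M)`, as the closed subspace of triples `(u, ∂u/∂x, ∂u/∂y)` in `L²(M)³`. -/
def H10 : Submodule ℂ (L2M × L2M × L2M) := testSub.topologicalClosure

lemma isClosed_H10 : IsClosed (H10 : Set (L2M × L2M × L2M)) :=
  testSub.isClosed_topologicalClosure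

/-- A closed property of test functions holds on `H¹₀(M)`. -/
lemma H10_induction {S : Set (L2M × L2M × L2M)} (hS : IsClosed S)
    (h : ∀ φ (hφ : IsTest φ),
      (hφ.toL2, (hφ.fderiv_apply 1).toL2, (hφ.fderiv_apply I).toL2) ∈ S)
    {t : L2M × L2M × L2M} (ht : t ∈ H10) : t ∈ S := by
  refine closure_minimal ?_ hS ht
  rintro ⟨u, p, q⟩ ⟨φ, hφ, h1, h2, h3⟩
  have e1 : u = hφ.toL2 := Lp.ext (h1.trans hφ.coeFn_toL2.symm)
  have e2 : p = (hφ.fderiv_apply 1).toL2 := Lp.ext (h2.trans (hφ.fderiv_apply 1).coeFn_toL2.symm)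
  have e3 : q = (hφ.fderiv_apply I).toL2 := Lp.ext (h3.trans (hφ.fderiv_apply I).coeFn_toL2.symm)
  rw [e1, e2, e3]
  exact h φ hφ

lemma test_mem_H10 {φ : ℂ → ℂ} (hφ : IsTest φ) :
    (hφ.toL2, (hφ.fderiv_apply 1).toL2, (hφ.fderiv_apply I).toL2) ∈ H10 :=
  subset_closure ⟨φ, hφ, hφ.coeFn_toL2, (hφ.fderiv_apply 1).coeFn_toL2,
    (hφ.fderiv_apply I).coeFn_toL2⟩

lemma continuous_integral_mul {ψ : ℂ → ℂ} (hψ : IsTest ψ) :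
    Continuous fun u : L2M => ∫ z, u z * ψ z ∂volM := by
  have h : ∀ u : L2M, ∫ z, u z * ψ z ∂volM = ⟪hψ.star.toL2, u⟫_ℂ := by
    intro u
    rw [L2.inner_def]
    refine integral_congr_ae ?_
    filter_upwards [hψ.star.coeFn_toL2] with z hz
    rw [hz, RCLike.inner_apply, Complex.conj_conj]
  simp only [h]
  fun_prop

lemma hasWeakGrad_of_mem_H10 {t : L2M × L2M × L2M} (ht : t ∈ H10) :
    HasWeakGrad t.1 t.2.1 t.2.2 := by
  intro ψ hψ
  have key : ∀ {φ χ : ℂ → ℂ} (hφ : IsTest φ) (hχ : IsTest χ), ∫ z, hφ.toL2 z * χ z ∂volM =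
      ∫ z, φ z * χ z ∂volM := fun hφ hχ => integral_congr_ae (by
    filter_upwards [hφ.coeFn_toL2] with z hz using by rw [hz])
  constructor
  · have c1 := (continuous_integral_mul (hψ.fderiv_apply 1)).comp
      (continuous_fst (X := L2M) (Y := L2M × L2M))
    have c2 := ((continuous_integral_mul hψ).comp
      ((continuous_fst (X := L2M) (Y := L2M)).comp (continuous_snd (X := L2M)))).neg
    refine H10_induction (isClosed_eq c1 c2) (fun φ hφ => ?_) ht
    change ∫ z, hφ.toL2 z * _ ∂volM = -∫ z, (hφ.fderiv_apply 1).toL2 z * _ ∂volM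
    rw [key hφ (hψ.fderiv_apply 1), key (hφ.fderiv_apply 1) hψ]
    exact hφ.integral_mul_fderiv hψ 1
  · have c1 := (continuous_integral_mul (hψ.fderiv_apply I)).comp
      (continuous_fst (X := L2M) (Y := L2M × L2M))
    have c2 := ((continuous_integral_mul hψ).comp
      ((continuous_snd (X := L2M) (Y := L2M)).comp (continuous_snd (X := L2M)))).neg
    refine H10_induction (isClosed_eq c1 c2) (fun φ hφ => ?_) ht
    change ∫ z, hφ.toL2 z * _ ∂volM = -∫ z, (hφ.fderiv_apply I).toL2 z * _ ∂volM
    rw [key hφ (hψ.fderiv_apply I), key (hφ.fderiv_apply I) hψ]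
    exact hφ.integral_mul_fderiv hψ I

lemma hasH10Grad_iff {u p q : L2M} : HasH10Grad u p q ↔ (u, p, q) ∈ H10 :=
  ⟨fun h => h.2, fun h => ⟨hasWeakGrad_of_mem_H10 h, h⟩⟩

lemma inner_grad_comm {t : L2M × L2M × L2M} (ht : t ∈ H10) :
    ⟪t.2.1, t.2.2⟫_ℂ = ⟪t.2.2, t.2.1⟫_ℂ := by
  refine H10_induction (S := {t | ⟪t.2.1, t.2.2⟫_ℂ = ⟪t.2.2, t.2.1⟫_ℂ})
    (isClosed_eq (by fun_prop) (by fun_prop)) (fun φ hφ => ?_) ht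
  have key : ∀ v w, ⟪(hφ.fderiv_apply v).toL2, (hφ.fderiv_apply w).toL2⟫_ℂ =
      ∫ z, fderiv ℝ φ z w * conj (fderiv ℝ φ z v) ∂volM := by
    intro v w
    rw [L2.inner_def]
    refine integral_congr_ae ?_
    filter_upwards [(hφ.fderiv_apply v).coeFn_toL2, (hφ.fderiv_apply w).coeFn_toL2] with z h1 h2
    rw [h1, h2, RCLike.inner_apply]
  rw [Set.mem_ofPred_eq, key, key]
  exact hφ.integral_fderiv_mul_conj _ _

/-- The first-order operator `(∂/∂x + c ∂/∂y) / 2` on triples `(u, ∂u/∂x, ∂u/∂y)`. It is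
`∂` for `c = -i` and `∂̄` for `c = i`. -/
def wirt (c : ℂ) : L2M × L2M × L2M →L[ℂ] L2M :=
  (1 / 2 : ℂ) • ((ContinuousLinearMap.fst ℂ L2M L2M + c • ContinuousLinearMap.snd ℂ L2M L2M).comp
    (ContinuousLinearMap.snd ℂ L2M (L2M × L2M)))

lemma wirt_apply (c : ℂ) (t : L2M × L2M × L2M) : wirt c t = (1 / 2 : ℂ) • (t.2.1 + c • t.2.2) := rfl

/-- The squared `L²` norm `‖∇u‖²` of the gradient. -/
def gradSq (t : L2M × L2M × L2M) : ℝ := ‖t.2.1‖ ^ 2 + ‖t.2.2‖ ^ 2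

lemma norm_wirt_sq {c : ℂ} (hc : c = I ∨ c = -I) {t : L2M × L2M × L2M} (ht : t ∈ H10) :
    4 * ‖wirt c t‖ ^ 2 = gradSq t := by
  have h0 := inner_grad_comm ht
  have him : (⟪t.2.1, t.2.2⟫_ℂ).im = 0 := by
    rw [← inner_conj_symm, Complex.conj_eq_iff_im] at h0
    have h1 := congrArg Complex.im (inner_conj_symm (𝕜 := ℂ) t.2.1 t.2.2)
    rw [Complex.conj_im, h0] at h1
    linarith
  have h1 := norm_add_sq (𝕜 := ℂ) t.2.1 (c • t.2.2)
  have h2 : RCLike.re ⟪t.2.1, c • t.2.2⟫_ℂ = 0 := by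
    rw [inner_smul_right]
    rcases hc with rfl | rfl <;> simp [him]
  have h3 : ‖c‖ = 1 := by rcases hc with rfl | rfl <;> simp
  rw [h2, norm_smul, h3, one_mul] at h1
  rw [wirt_apply, norm_smul, mul_pow, h1, gradSq]
  norm_num
  ring

lemma continuous_gradSq : Continuous gradSq := by unfold gradSq; fun_prop

lemma norm_test_le : ∃ C : ℝ, 0 ≤ C ∧ ∀ φ (hφ : IsTest φ),
    ‖hφ.toL2‖ ≤ C * (‖(hφ.fderiv_apply 1).toL2‖ + ‖(hφ.fderiv_apply I).toL2‖) := by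
  set K : NNReal := eLpNormLESNormFDerivOfLeConst ℂ (volume : Measure ℂ) disc 1 2
  set V : ENNReal := volM Set.univ ^ (1 / (1 : ENNReal).toReal - 1 / (2 : ENNReal).toReal)
  have hV : V ≠ ⊤ := ENNReal.rpow_ne_top_of_nonneg (by norm_num) (measure_ne_top _ _)
  refine ⟨K * V.toReal, by positivity, fun φ hφ => ?_⟩
  have hsupp : φ.support ⊆ disc :=
    (subset_tsupport φ).trans (hφ.2.2.trans Metric.ball_subset_closedBall)
  have h1 : eLpNorm φ 2 volume ≤ K * eLpNorm (fderiv ℝ φ) 1 volume := by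
    have h := eLpNorm_le_eLpNorm_fderiv_of_le (F := ℂ) (volume : Measure ℂ)
      (hφ.1.of_le (by simp)) hsupp (p := 1) (q := 2) le_rfl
      (by rw [Complex.finrank_real_complex]; norm_num)
      (by rw [Complex.finrank_real_complex]; norm_num) Metric.isBounded_closedBall
    simpa using h
  have h2 : eLpNorm (fderiv ℝ φ) 1 volume = eLpNorm (fderiv ℝ φ) 1 volM := by
    have hs : (fderiv ℝ φ).support ⊆ disc := (subset_tsupport _).trans
      ((tsupport_fderiv_subset ℝ).trans (hφ.2.2.trans Metric.ball_subset_closedBall))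
    exact (eLpNorm_restrict_eq_of_support_subset hs).symm
  have hm : AEStronglyMeasurable (fderiv ℝ φ) volM :=
    (hφ.1.continuous_fderiv (by simp)).aestronglyMeasurable
  have h3 : eLpNorm (fderiv ℝ φ) 1 volM ≤ eLpNorm (fderiv ℝ φ) 2 volM * V :=
    eLpNorm_le_eLpNorm_mul_rpow_measure_univ (by norm_num) hm
  have h4 : eLpNorm (fderiv ℝ φ) 2 volM ≤
      eLpNorm ((fun z => ‖fderiv ℝ φ z 1‖) + fun z => ‖fderiv ℝ φ z I‖) 2 volM := by
    refine eLpNorm_mono_real fun z => ?_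
    refine ContinuousLinearMap.opNorm_le_bound _ (by simp only [Pi.add_apply]; positivity)
      fun v => ?_
    have hv : fderiv ℝ φ z v = v.re • fderiv ℝ φ z 1 + v.im • fderiv ℝ φ z I := by
      rw [← map_smul, ← map_smul, ← map_add]
      congr 1
      simp
    rw [hv]
    refine (norm_add_le _ _).trans ?_
    rw [norm_smul, norm_smul, Pi.add_apply, add_mul, mul_comm _ ‖v‖, mul_comm _ ‖v‖]
    have h1 := Complex.abs_re_le_norm v
    have h2 := Complex.abs_im_le_norm v
    rw [← Real.norm_eq_abs] at h1 h2
    gcongr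
  have h5 : eLpNorm ((fun z => ‖fderiv ℝ φ z 1‖) + fun z => ‖fderiv ℝ φ z I‖) 2 volM ≤
      eLpNorm (fun z => fderiv ℝ φ z 1) 2 volM + eLpNorm (fun z => fderiv ℝ φ z I) 2 volM := by
    refine (eLpNorm_add_le (hφ.fderiv_apply 1).memLp.1.norm (hφ.fderiv_apply I).memLp.1.norm
      (by norm_num)).trans ?_
    rw [eLpNorm_norm, eLpNorm_norm]
  have h6 : eLpNorm φ 2 volM ≤ K * ((eLpNorm (fun z => fderiv ℝ φ z 1) 2 volM +
      eLpNorm (fun z => fderiv ℝ φ z I) 2 volM) * V) := by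
    refine (eLpNorm_restrict_le φ 2 volume disc).trans (h1.trans ?_)
    rw [h2]
    gcongr
    exact h3.trans (by gcongr; exact h4.trans h5)
  have f1 := (hφ.fderiv_apply 1).memLp.2.ne
  have f2 := (hφ.fderiv_apply I).memLp.2.ne
  have h7 := ENNReal.toReal_mono (ENNReal.mul_ne_top ENNReal.coe_ne_top
    (ENNReal.mul_ne_top (ENNReal.add_ne_top.2 ⟨f1, f2⟩) hV)) h6
  rw [ENNReal.toReal_mul, ENNReal.toReal_mul, ENNReal.toReal_add f1 f2] at h7
  rw [IsTest.toL2, IsTest.toL2, IsTest.toL2, Lp.norm_toLp, Lp.norm_toLp, Lp.norm_toLp]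
  refine h7.trans (le_of_eq ?_)
  rw [ENNReal.coe_toReal]; ring

/-- The Poincaré inequality, with some constant. -/
lemma exists_poincare : ∃ C : ℝ, 0 < C ∧ ∀ t ∈ H10, ‖t.1‖ ^ 2 ≤ C * gradSq t := by
  obtain ⟨C, hC, h⟩ := norm_test_le
  refine ⟨2 * C ^ 2 + 1, by positivity, fun t ht => ?_⟩
  refine H10_induction (S := {t | ‖t.1‖ ^ 2 ≤ (2 * C ^ 2 + 1) * gradSq t})
    (isClosed_le (by fun_prop) (continuous_const.mul continuous_gradSq)) (fun φ hφ => ?_) ht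
  have h1 := h φ hφ
  rw [Set.mem_ofPred_eq, gradSq]
  dsimp only
  set x := ‖(hφ.fderiv_apply 1).toL2‖
  set y := ‖(hφ.fderiv_apply I).toL2‖
  have h2 : ‖hφ.toL2‖ ^ 2 ≤ (C * (x + y)) ^ 2 := pow_le_pow_left₀ (norm_nonneg _) h1 2
  have h3 : C ^ 2 * (x + y) ^ 2 ≤ C ^ 2 * (2 * (x ^ 2 + y ^ 2)) :=
    mul_le_mul_of_nonneg_left (by nlinarith [sq_nonneg (x - y)]) (sq_nonneg C)
  nlinarith [sq_nonneg x, sq_nonneg y]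

lemma poincareConst_nonneg : 0 ≤ poincareConst := Real.sInf_nonneg fun _ h => h.1.le

/-- The infimum defining the Poincaré constant is attained. -/
lemma norm_sq_le_poincareConst {t : L2M × L2M × L2M} (ht : t ∈ H10) :
    ‖t.1‖ ^ 2 ≤ poincareConst * gradSq t := by
  obtain ⟨C₀, hC₀, h₀⟩ := exists_poincare
  have hmem : C₀ ∈ {C : ℝ | 0 < C ∧ ∀ u p q : L2M, HasH10Grad u p q →
      ‖u‖ ^ 2 ≤ C * (‖p‖ ^ 2 + ‖q‖ ^ 2)} :=
    ⟨hC₀, fun u p q h => h₀ (u, p, q) (hasH10Grad_iff.1 h)⟩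
  have hg : 0 ≤ gradSq t := by unfold gradSq; positivity
  rcases hg.eq_or_lt with h | h
  · have h1 := h₀ t ht
    rw [← h, mul_zero] at h1 ⊢
    exact h1
  · rw [← div_le_iff₀ h]
    refine le_csInf ⟨C₀, hmem⟩ fun C hC => ?_
    rw [div_le_iff₀ h]
    exact hC.2 _ _ _ (hasH10Grad_iff.2 ht)

/-! ### Transport of `H¹₀` functions into the kernel of the transform -/

section transport

variable {a : ℂ → ℂ} (ha : ContinuousOn a disc)

include ha

lemma ae_norm_mul_le (u : L2M) : ∀ᵐ z ∂volM, ‖a z * u z‖ ≤ supM a * ‖u z‖ := by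
  filter_upwards [ae_restrict_mem measurableSet_disc] with z hz
  rw [norm_mul]
  gcongr
  exact norm_le_supM ha hz

lemma memLp_mul (u : L2M) : MemLp (fun z => a z * u z) 2 volM := by
  refine (Lp.memLp u).of_le_mul (c := supM a) ?_ (ae_norm_mul_le ha u)
  exact (ha.aestronglyMeasurable measurableSet_disc).mul (Lp.aestronglyMeasurable u)

/-- Multiplication by the attenuation `a`, as an operator on `L²(M)`. -/
def mulA : L2M →L[ℂ] L2M :=
  LinearMap.mkContinuous
    { toFun := fun u => (memLp_mul ha u).toLp _
      map_add' := fun u v => by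
        rw [← MemLp.toLp_add]
        refine MemLp.toLp_congr _ _ ?_
        filter_upwards [Lp.coeFn_add u v] with z hz
        rw [hz, Pi.add_apply, mul_add]; rfl
      map_smul' := fun c u => by
        rw [RingHom.id_apply, ← MemLp.toLp_const_smul]
        refine MemLp.toLp_congr _ _ ?_
        filter_upwards [Lp.coeFn_smul c u] with z hz
        rw [hz, Pi.smul_apply, smul_eq_mul, mul_left_comm]; rfl }
    (supM a) fun u => by
      refine Lp.norm_le_mul_norm_of_ae_le_mul ?_
      filter_upwards [(memLp_mul ha u).coeFn_toLp, ae_norm_mul_le ha u] with z h1 h2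
      exact (congrArg norm h1).trans_le h2

lemma coeFn_mulA (u : L2M) : mulA ha u =ᵐ[volM] fun z => a z * u z := (memLp_mul ha u).coeFn_toLp

lemma norm_mulA_le (u : L2M) : ‖mulA ha u‖ ≤ supM a * ‖u‖ := by
  refine Lp.norm_le_mul_norm_of_ae_le_mul ?_
  filter_upwards [coeFn_mulA ha u, ae_norm_mul_le ha u] with z h1 h2
  rwa [h1]

/-- The function `(X + a)(u(x) e^{inθ})` on `SM`, where `X = cos θ ∂/∂x + sin θ ∂/∂y` is
`e^{iθ} ∂ + e^{-iθ} ∂̄`, as a map of the triple `(u, ∂u/∂x, ∂u/∂y)`. -/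
def transport (n : ℤ) : L2M × L2M × L2M →L[ℂ] L2SM :=
  (mode (n + 1)).comp (wirt (-I)) + (mode (n - 1)).comp (wirt I) +
    (mode n).comp ((mulA ha).comp (ContinuousLinearMap.fst ℂ L2M (L2M × L2M)))

lemma transport_apply (n : ℤ) (t : L2M × L2M × L2M) : transport ha n t =
    mode (n + 1) (wirt (-I) t) + mode (n - 1) (wirt I t) + mode n (mulA ha t.1) := rfl

omit ha in
lemma coeFn_wirt (c : ℂ) (t : L2M × L2M × L2M) :
    wirt c t =ᵐ[volM] fun z => (1 / 2 : ℂ) * (t.2.1 z + c * t.2.2 z) := by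
  rw [wirt_apply]
  filter_upwards [Lp.coeFn_smul (1 / 2 : ℂ) (t.2.1 + c • t.2.2), Lp.coeFn_add t.2.1 (c • t.2.2),
    Lp.coeFn_smul c t.2.2] with z h1 h2 h3
  rw [h1, Pi.smul_apply, h2, Pi.add_apply, h3]; rfl

omit ha in
lemma fourier_one_eq_dir (θ : Circ) : (fourier 1 θ : ℂ) = dir θ := fourier_one

omit ha in
lemma fourier_succ (n : ℤ) (θ : Circ) : (fourier (n + 1) θ : ℂ) = fourier n θ * dir θ := by
  rw [fourier_add, fourier_one_eq_dir]

omit ha in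
lemma fourier_pred (n : ℤ) (θ : Circ) :
    (fourier (n - 1) θ : ℂ) = fourier n θ * conj (dir θ) := by
  rw [sub_eq_add_neg, fourier_add, fourier_neg, fourier_one_eq_dir]

lemma transport_test (n : ℤ) {φ : ℂ → ℂ} (hφ : IsTest φ) :
    transport ha n (hφ.toL2, (hφ.fderiv_apply 1).toL2, (hφ.fderiv_apply I).toL2) =ᵐ[volSM]
      fun s => (fderiv ℝ φ s.1 (dir s.2) + a s.1 * φ s.1) * fourier n s.2 := by
  rw [transport_apply]
  set t : L2M × L2M × L2M := (hφ.toL2, (hφ.fderiv_apply 1).toL2, (hφ.fderiv_apply I).toL2)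
  filter_upwards [Lp.coeFn_add (mode (n + 1) (wirt (-I) t) + mode (n - 1) (wirt I t))
      (mode n (mulA ha t.1)), Lp.coeFn_add (mode (n + 1) (wirt (-I) t)) (mode (n - 1) (wirt I t)),
    coeFn_mode (n + 1) (wirt (-I) t), coeFn_mode (n - 1) (wirt I t), coeFn_mode n (mulA ha t.1),
    ae_fst (coeFn_wirt (-I) t), ae_fst (coeFn_wirt I t), ae_fst (coeFn_mulA ha t.1),
    ae_fst hφ.coeFn_toL2, ae_fst (hφ.fderiv_apply 1).coeFn_toL2,
    ae_fst (hφ.fderiv_apply I).coeFn_toL2] with s h1 h2 h3 h4 h5 h6 h7 h8 h9 h10 h11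
  rw [h1, Pi.add_apply, h2, Pi.add_apply, h3, h4, h5, h6, h7, h8]
  change _ * ((hφ.fderiv_apply 1).toL2 s.1 + _ * (hφ.fderiv_apply I).toL2 s.1) * _ +
    _ * ((hφ.fderiv_apply 1).toL2 s.1 + _ * (hφ.fderiv_apply I).toL2 s.1) * _ +
    _ * hφ.toL2 s.1 * _ = _
  rw [h9, h10, h11, fourier_succ, fourier_pred]
  set v := dir s.2
  have hv : fderiv ℝ φ s.1 v = (v.re : ℂ) * fderiv ℝ φ s.1 1 + (v.im : ℂ) * fderiv ℝ φ s.1 I := by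
    rw [← Complex.real_smul, ← Complex.real_smul, ← map_smul, ← map_smul, ← map_add]
    congr 1
    simp
  have e1 : v = v.re + v.im * I := (Complex.re_add_im v).symm
  have e2 : conj v = v.re - v.im * I := by
    apply Complex.ext <;> simp
  rw [hv, e2]
  nth_rewrite 1 [e1]
  linear_combination (-(fourier n s.2) * v.im * fderiv ℝ φ s.1 I) * Complex.I_sq

/-- Along a geodesic, `(X + a)(φ e^{inθ})` times the weight is a total derivative, and `φ` vanishes
at both ends. -/
lemma attXray_transport_test (n : ℤ) {φ : ℂ → ℂ} (hφ : IsTest φ) {b : Circ × ℝ}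
    (hb : 0 < Real.cos b.2) :
    attXray a (fun s => (fderiv ℝ φ s.1 (dir s.2) + a s.1 * φ s.1) * fourier n s.2) b = 0 := by
  have hab : (0 : ℝ) ≤ 2 * Real.cos b.2 := by linarith
  set e : ℂ := fourier n (fanAngle b)
  have hg : Continuous fun t : ℝ => geod b t :=
    continuous_geod.comp (by fun_prop : Continuous fun t : ℝ => (b, t))
  have hag := continuousOn_comp_geod ha b
  have hw := continuousOn_weight ha b
  have hgd : ∀ t : ℝ, HasDerivAt (fun t : ℝ => geod b t) (dir (fanAngle b)) t := by
    intro t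
    have h := ((Complex.ofRealCLM.hasDerivAt (x := t)).mul_const (dir (fanAngle b))).const_add
      (dir b.1)
    simpa [geod] using h
  have hφd : ∀ t : ℝ, HasDerivAt (fun t : ℝ => φ (geod b t))
      (fderiv ℝ φ (geod b t) (dir (fanAngle b))) t := fun t =>
    (hφ.differentiable _).hasFDerivAt.comp_hasDerivAt t (hgd t)
  have hwd : ∀ t ∈ Set.Ioo 0 (2 * Real.cos b.2),
      HasDerivAt (weight a b) (weight a b t * a (geod b t)) t := by
    intro t ht
    have hci : IntervalIntegrable (fun s => a (geod b s)) volume 0 t :=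
      (hag.mono (Set.Icc_subset_Icc_right ht.2.le)).intervalIntegrable_of_Icc ht.1.le
    have hn : Set.Icc 0 (2 * Real.cos b.2) ∈ 𝓝 t := Icc_mem_nhds ht.1 ht.2
    exact (intervalIntegral.integral_hasDerivAt_right hci
      (hag.stronglyMeasurableAtFilter_nhdsWithin measurableSet_Icc t |>.filter_mono
        (le_of_eq (nhdsWithin_eq_nhds.2 hn).symm)) (hag.continuousAt hn)).cexp
  have hcont : ContinuousOn (fun t => φ (geod b t) * e * weight a b t)
      (Set.Icc 0 (2 * Real.cos b.2)) :=
    (((hφ.1.continuous.comp hg).continuousOn).mul continuousOn_const).mul hw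
  have hder : ∀ t ∈ Set.Ioo 0 (2 * Real.cos b.2),
      HasDerivAt (fun t => φ (geod b t) * e * weight a b t)
        ((fderiv ℝ φ (geod b t) (dir (fanAngle b)) + a (geod b t) * φ (geod b t)) * e *
          weight a b t) t := by
    intro t ht
    refine (((hφd t).mul_const e).mul (hwd t ht)).congr_deriv ?_
    ring
  have hint : IntervalIntegrable (fun t => (fderiv ℝ φ (geod b t) (dir (fanAngle b)) +
      a (geod b t) * φ (geod b t)) * e * weight a b t) volume 0 (2 * Real.cos b.2) := by
    refine ContinuousOn.intervalIntegrable_of_Icc hab ?_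
    have h1 := ((hφ.fderiv_apply (dir (fanAngle b))).1.continuous.comp hg).continuousOn
      (s := Set.Icc 0 (2 * Real.cos b.2))
    exact ((h1.add (hag.mul (hφ.1.continuous.comp hg).continuousOn)).mul continuousOn_const).mul hw
  have h := intervalIntegral.integral_eq_sub_of_hasDerivAt_of_le hab hcont hder hint
  rw [attXray]
  refine Eq.trans h ?_
  rw [hφ.eq_zero (norm_geod_exit b).ge, hφ.eq_zero (norm_geod_zero b).ge]
  simp

lemma transport_mem_xrayKer (n : ℤ) {t : L2M × L2M × L2M} (ht : t ∈ H10) :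
    transport ha n t ∈ xrayKer ha := by
  refine H10_induction (S := transport ha n ⁻¹' (xrayKer ha : Set L2SM))
    ((isClosed_xrayKer ha).preimage (transport ha n).continuous) (fun φ hφ => ?_) ht
  refine (mem_xrayKer ha).2 ((attXray_congr_ae a (transport_test ha n hφ)).trans ?_)
  filter_upwards [ae_cos_pos] with b hb
  exact attXray_transport_test ha n hφ hb

end transport

/-! ### Weyl's lemma for the Cauchy–Riemann operator -/

/-- A smooth nonnegative profile supported in `[1/4, 1]`. Vanishing near `0` keeps the primitive
`bumpPotential` below smooth at the origin. -/
def profile (t : ℝ) : ℝ := expNegInvGlue (t - 1 / 4) * expNegInvGlue (1 - t)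

lemma contDiff_profile : ContDiff ℝ ∞ profile :=
  (expNegInvGlue.contDiff.comp (contDiff_id.sub contDiff_const)).mul
    (expNegInvGlue.contDiff.comp (contDiff_const.sub contDiff_id))

lemma profile_nonneg (t : ℝ) : 0 ≤ profile t :=
  mul_nonneg (expNegInvGlue.nonneg _) (expNegInvGlue.nonneg _)

lemma profile_of_le {t : ℝ} (ht : t ≤ 1 / 4) : profile t = 0 := by
  rw [profile, expNegInvGlue.zero_of_nonpos (by linarith), zero_mul]

lemma profile_of_ge {t : ℝ} (ht : 1 ≤ t) : profile t = 0 := by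
  rw [profile, expNegInvGlue.zero_of_nonpos (x := 1 - t) (by linarith), mul_zero]

/-- The primitive of `profile`. -/
def profileInt (t : ℝ) : ℝ := ∫ x in (0 : ℝ)..t, profile x

lemma hasDerivAt_profileInt (t : ℝ) : HasDerivAt profileInt (profile t) t :=
  intervalIntegral.integral_hasDerivAt_right (contDiff_profile.continuous.intervalIntegrable _ _)
    contDiff_profile.continuous.stronglyMeasurable.stronglyMeasurableAtFilter
    contDiff_profile.continuous.continuousAt

lemma contDiff_profileInt : ContDiff ℝ ∞ profileInt := by
  rw [contDiff_infty_iff_deriv]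
  refine ⟨fun t => (hasDerivAt_profileInt t).differentiableAt, ?_⟩
  rw [funext fun t => (hasDerivAt_profileInt t).deriv]
  exact contDiff_profile

lemma profileInt_of_le {t : ℝ} (ht : t ≤ 1 / 4) : profileInt t = 0 := by
  rw [profileInt, intervalIntegral.integral_congr (g := fun _ => 0) fun x hx => ?_]
  · simp
  · refine profile_of_le (hx.2.trans (max_le (by norm_num) ht))

lemma profileInt_of_ge {t : ℝ} (ht : 1 ≤ t) : profileInt t = profileInt 1 := by
  have h := intervalIntegral.integral_add_adjacent_intervals
    (contDiff_profile.continuous.intervalIntegrable (μ := volume) 0 1)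
    (contDiff_profile.continuous.intervalIntegrable (μ := volume) 1 t)
  rw [profileInt, profileInt, ← h, add_eq_left,
    intervalIntegral.integral_congr (g := fun _ => 0) fun x hx => ?_]
  · simp
  · rw [Set.uIcc_of_le ht] at hx
    exact profile_of_ge hx.1

/-- The operator `2 ∂̄ = ∂/∂x + i ∂/∂y`. -/
def dbar (φ : ℂ → ℂ) (z : ℂ) : ℂ := fderiv ℝ φ z 1 + I * fderiv ℝ φ z I

/-- The mass of the radial kernel `profile (|z|²)`. -/
def bumpMass : ℝ := ∫ z : ℂ, profile (normSq z)

lemma continuous_profile_normSq : Continuous fun z : ℂ => profile (normSq z) :=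
  contDiff_profile.continuous.comp Complex.continuous_normSq

lemma profile_normSq_of_ge {z : ℂ} (hz : 1 ≤ ‖z‖) : profile (normSq z) = 0 := by
  refine profile_of_ge ?_
  rw [normSq_eq_norm_sq]
  exact one_le_pow₀ hz

lemma hasCompactSupport_profile_normSq : HasCompactSupport fun z : ℂ => profile (normSq z) := by
  refine HasCompactSupport.intro (isCompact_closedBall (0 : ℂ) 1) fun z hz => ?_
  rw [mem_closedBall_zero_iff, not_le] at hz
  exact profile_normSq_of_ge hz.le

lemma bumpMass_pos : 0 < bumpMass := by
  refine continuous_profile_normSq.integral_pos_of_hasCompactSupport_nonneg_nonzero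
    hasCompactSupport_profile_normSq (fun z => profile_nonneg _)
    (x := ((Real.sqrt (1 / 2) : ℝ) : ℂ)) ?_
  rw [normSq_ofReal, Real.mul_self_sqrt (by norm_num)]
  exact (mul_pos (expNegInvGlue.pos_of_pos (by norm_num))
    (expNegInvGlue.pos_of_pos (by norm_num))).ne'

/-- A smooth radial approximate identity, supported in the disc of radius `ε`. -/
def radialBump (ε : ℝ) (z : ℂ) : ℂ := ((ε ^ 2)⁻¹ * bumpMass⁻¹ * profile (normSq z / ε ^ 2) : ℝ)

/-- A solution `Ψ` of `∂̄Ψ = radialBump ε` that equals a constant multiple of `1 / z` for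
`|z| ≥ ε`, the constant not depending on `ε`. -/
def bumpPotential (ε : ℝ) (z : ℂ) : ℂ :=
  ((bumpMass⁻¹ * profileInt (normSq z / ε ^ 2) : ℝ) : ℂ) * z⁻¹

lemma contDiff_normSq_div (ε : ℝ) : ContDiff ℝ ∞ fun z : ℂ => normSq z / ε ^ 2 := by
  have : (fun z : ℂ => normSq z / ε ^ 2) = fun z : ℂ => ‖z‖ ^ 2 / ε ^ 2 := by
    ext z; rw [normSq_eq_norm_sq]
  rw [this]
  exact (contDiff_norm_sq ℝ).div_const _

lemma contDiff_radialBump (ε : ℝ) : ContDiff ℝ ∞ (radialBump ε) :=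
  Complex.ofRealCLM.contDiff.comp
    (contDiff_const.mul (contDiff_profile.comp (contDiff_normSq_div ε)))

lemma one_le_normSq_div {ε : ℝ} (hε : 0 < ε) {z : ℂ} (hz : ε ≤ ‖z‖) : 1 ≤ normSq z / ε ^ 2 := by
  rw [normSq_eq_norm_sq, one_le_div (by positivity)]
  exact pow_le_pow_left₀ hε.le hz 2

lemma radialBump_eq_zero {ε : ℝ} (hε : 0 < ε) {z : ℂ} (hz : ε ≤ ‖z‖) : radialBump ε z = 0 := by
  rw [radialBump, profile_of_ge (one_le_normSq_div hε hz)]; simp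

lemma bumpPotential_eventuallyEq_zero {ε : ℝ} (hε : 0 < ε) : bumpPotential ε =ᶠ[𝓝 0] 0 := by
  filter_upwards [Metric.ball_mem_nhds (0 : ℂ) (half_pos hε)] with z hz
  rw [mem_ball_zero_iff] at hz
  have h : normSq z / ε ^ 2 ≤ 1 / 4 := by
    rw [normSq_eq_norm_sq, div_le_iff₀ (by positivity)]
    nlinarith [norm_nonneg z]
  rw [bumpPotential, profileInt_of_le h]; simp

lemma contDiff_bumpPotential {ε : ℝ} (hε : 0 < ε) : ContDiff ℝ ∞ (bumpPotential ε) := by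
  rw [contDiff_iff_contDiffAt]
  intro z
  rcases eq_or_ne z 0 with rfl | hz
  · exact contDiffAt_const.congr_of_eventuallyEq (bumpPotential_eventuallyEq_zero hε)
  · exact (Complex.ofRealCLM.contDiff.comp (contDiff_const.mul
      (contDiff_profileInt.comp (contDiff_normSq_div ε)))).contDiffAt.mul
      (contDiffAt_id.inv hz)

lemma dbar_bumpPotential {ε : ℝ} (hε : 0 < ε) (z : ℂ) :
    dbar (bumpPotential ε) z = 2 * radialBump ε z := by
  rcases eq_or_ne z 0 with rfl | hz
  · rw [dbar, (bumpPotential_eventuallyEq_zero hε).fderiv_eq, radialBump, profile_of_le (by simp)]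
    simp
  · have hn : HasFDerivAt (fun z : ℂ => normSq z) ((2 * z.re) • reCLM + (2 * z.im) • imCLM) z := by
      have h1 := (reCLM.hasFDerivAt (x := z)).mul (reCLM.hasFDerivAt (x := z))
      have h2 := (imCLM.hasFDerivAt (x := z)).mul (imCLM.hasFDerivAt (x := z))
      refine (h1.add h2).congr_fderiv ?_
      ext v
      simp
      ring
    have h1 := ((hasDerivAt_profileInt (normSq z / ε ^ 2)).comp_hasFDerivAt z
      (hn.mul_const ((ε ^ 2)⁻¹))).const_mul bumpMass⁻¹
    have h2 := Complex.ofRealCLM.hasFDerivAt.comp z h1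
    have h3 : HasFDerivAt (fun z : ℂ => z⁻¹)
        ((ContinuousLinearMap.toSpanSingleton ℂ (-(z ^ 2)⁻¹)).restrictScalars ℝ) z :=
      (hasDerivAt_inv hz).hasFDerivAt.restrictScalars ℝ
    have h4 : HasFDerivAt (bumpPotential ε) _ z := h2.mul h3
    rw [dbar, h4.fderiv, radialBump]
    simp
    have hinv : z⁻¹ * (z.re + z.im * I) = 1 := by rw [Complex.re_add_im, inv_mul_cancel₀ hz]
    rw [div_eq_mul_inv (normSq z)]
    linear_combination
      (-((bumpMass : ℂ)⁻¹ * profileInt (normSq z * (ε ^ 2)⁻¹) * (z ^ 2)⁻¹)) * Complex.I_sq +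
      2 * (bumpMass : ℂ)⁻¹ * profile (normSq z * (ε ^ 2)⁻¹) * ((ε : ℂ) ^ 2)⁻¹ * hinv

lemma integral_radialBump {ε : ℝ} (hε : 0 < ε) : ∫ z, radialBump ε z = 1 := by
  have h1 : ∀ z : ℂ, profile (normSq z / ε ^ 2) = profile (normSq (ε⁻¹ • z)) := by
    intro z
    rw [normSq_eq_norm_sq, normSq_eq_norm_sq, norm_smul, norm_inv, Real.norm_of_nonneg hε.le]
    congr 1
    field_simp
  have h2 := Measure.integral_comp_inv_smul_of_nonneg (volume : Measure ℂ)
    (fun z => profile (normSq z)) hε.le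
  simp only [radialBump]
  rw [integral_complex_ofReal, integral_const_mul]
  simp only [h1]
  rw [h2, Complex.finrank_real_complex, ← bumpMass, smul_eq_mul]
  have := bumpMass_pos.ne'
  norm_cast
  field_simp

lemma exists_norm_radialBump_le :
    ∃ K : ℝ, 0 ≤ K ∧ ∀ ε > 0, ∀ z, ‖radialBump ε z‖ ≤ (ε ^ 2)⁻¹ * K := by
  obtain ⟨K, hK⟩ := hasCompactSupport_profile_normSq.exists_bound_of_continuous
    continuous_profile_normSq
  have hK0 : 0 ≤ K := (norm_nonneg _).trans (hK 0)
  refine ⟨bumpMass⁻¹ * K, mul_nonneg (inv_nonneg.2 bumpMass_pos.le) hK0, fun ε hε z => ?_⟩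
  have h := hK (ε⁻¹ • z)
  have h1 : normSq (ε⁻¹ • z) = normSq z / ε ^ 2 := by
    rw [normSq_eq_norm_sq, normSq_eq_norm_sq, norm_smul, norm_inv, Real.norm_of_nonneg hε.le]
    field_simp
  rw [h1] at h
  rw [radialBump, Complex.norm_real, norm_mul, norm_mul, Real.norm_of_nonneg (by positivity),
    Real.norm_of_nonneg (inv_nonneg.2 bumpMass_pos.le), mul_assoc]
  have := bumpMass_pos
  gcongr

section weyl

variable {S : ℂ → ℂ} (hS : Integrable S)
  (hw : ∀ φ : ℂ → ℂ, IsTest φ → ∫ z, S z * dbar φ z = 0)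

/-- The mollification of `S` by the radial bump. -/
def mollify (S : ℂ → ℂ) (ε : ℝ) (z : ℂ) : ℂ := ∫ ζ, S ζ * radialBump ε (z - ζ)

include hw in
lemma integral_mul_dbar_sub_eq_zero {ψ : ℂ → ℂ} (hψ : ContDiff ℝ ∞ ψ) {r : ℝ}
    (h0 : ∀ w, r ≤ ‖w‖ → ψ w = 0) {z : ℂ} (hz : ‖z‖ + r < 1) :
    ∫ ζ, S ζ * dbar ψ (z - ζ) = 0 := by
  have hsupp : tsupport (fun ζ => ψ (z - ζ)) ⊆ Metric.closedBall z r := by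
    refine closure_minimal (fun ζ hζ => ?_) Metric.isClosed_closedBall
    by_contra hcon
    rw [Metric.mem_closedBall, dist_comm, dist_eq_norm, not_le] at hcon
    exact hζ (h0 _ hcon.le)
  have htest : IsTest fun ζ => ψ (z - ζ) := by
    refine ⟨hψ.comp (contDiff_const.sub contDiff_id),
      (isCompact_closedBall z r).of_isClosed_subset (isClosed_tsupport _) hsupp,
      hsupp.trans fun ζ hζ => ?_⟩
    rw [mem_ball_zero_iff]
    rw [mem_closedBall_iff_norm] at hζ
    have := norm_add_le z (ζ - z)
    rw [add_sub_cancel] at this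
    linarith
  have hd : ∀ ζ, dbar (fun ζ => ψ (z - ζ)) ζ = -dbar ψ (z - ζ) := by
    intro ζ
    have h1 : HasFDerivAt (fun ζ => ψ (z - ζ)) ((fderiv ℝ ψ (z - ζ)).comp
        (-ContinuousLinearMap.id ℝ ℂ)) ζ :=
      ((hψ.differentiable (by simp)) (z - ζ)).hasFDerivAt.comp ζ
        ((hasFDerivAt_id ζ).const_sub z)
    rw [dbar, dbar, h1.fderiv]
    simp
    ring
  have h := hw _ htest
  simp only [hd, mul_neg, integral_neg, neg_eq_zero] at h
  exact h

include hS

lemma integrable_mul_radialBump {ε : ℝ} (hε : 0 < ε) (z : ℂ) :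
    Integrable fun ζ => S ζ * radialBump ε (z - ζ) := by
  obtain ⟨K, -, hK⟩ := exists_norm_radialBump_le
  refine hS.mul_bdd (c := (ε ^ 2)⁻¹ * K) ?_ (Eventually.of_forall fun ζ => hK ε hε _)
  exact ((contDiff_radialBump ε).continuous.comp (by fun_prop)).aestronglyMeasurable

include hw in
/-- Since the difference of two radial bumps is `∂̄` of a compactly supported function, the
mollification of a weakly holomorphic function does not depend on the scale. -/
lemma mollify_eq {ε δ : ℝ} (hε : 0 < ε) (hδ : 0 < δ) {z : ℂ} (h1 : ‖z‖ + ε < 1)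
    (h2 : ‖z‖ + δ < 1) : mollify S ε z = mollify S δ z := by
  have hc := contDiff_bumpPotential hε
  have hc' := contDiff_bumpPotential hδ
  have h0 : ∀ w, max ε δ ≤ ‖w‖ → (bumpPotential ε - bumpPotential δ) w = 0 := by
    intro w hw
    rw [Pi.sub_apply, bumpPotential, bumpPotential,
      profileInt_of_ge (one_le_normSq_div hε ((le_max_left _ _).trans hw)),
      profileInt_of_ge (one_le_normSq_div hδ ((le_max_right _ _).trans hw)), sub_self]
  have h := integral_mul_dbar_sub_eq_zero hw
    (ψ := bumpPotential ε - bumpPotential δ) (hc.sub hc') h0 (z := z)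
    (by rcases max_cases ε δ with h | h <;> linarith)
  have hd : ∀ w, dbar (bumpPotential ε - bumpPotential δ) w
      = 2 * radialBump ε w - 2 * radialBump δ w := by
    intro w
    rw [← dbar_bumpPotential hε, ← dbar_bumpPotential hδ, dbar,
      fderiv_sub (hc.differentiable (by simp) w) (hc'.differentiable (by simp) w), dbar, dbar]
    simp
    ring
  simp only [hd] at h
  have h3 : ∫ ζ, (2 : ℂ) * (S ζ * radialBump ε (z - ζ) - S ζ * radialBump δ (z - ζ)) = 0 := by
    rw [← h]
    refine integral_congr_ae (Eventually.of_forall fun ζ => ?_)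
    simp only
    ring
  rw [integral_const_mul, integral_sub (integrable_mul_radialBump hS hε z)
    (integrable_mul_radialBump hS hδ z)] at h3
  exact sub_eq_zero.1 ((mul_eq_zero.1 h3).resolve_left two_ne_zero)

open scoped Convolution in
include hw in
lemma differentiableAt_mollify {ε : ℝ} (hε : 0 < ε) {z : ℂ} (hz : ‖z‖ + ε < 1) :
    DifferentiableAt ℂ (mollify S ε) z := by
  have hcs : HasCompactSupport (radialBump ε) :=
    HasCompactSupport.intro (isCompact_closedBall (0 : ℂ) ε) fun w hw => by
      rw [mem_closedBall_zero_iff, not_le] at hw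
      exact radialBump_eq_zero hε hw.le
  have hc := contDiff_radialBump ε
  have h1 := hcs.hasFDerivAt_convolution_right (ContinuousLinearMap.mul ℝ ℂ)
    hS.locallyIntegrable (hc.of_le (by simp)) z
  have h2 : ∀ v, (S ⋆[(ContinuousLinearMap.mul ℝ ℂ).precompR ℂ, volume] fderiv ℝ (radialBump ε)) z v
      = ∫ ζ, S ζ * fderiv ℝ (radialBump ε) (z - ζ) v := by
    intro v
    rw [convolution_precompR_apply _ hS.locallyIntegrable (hcs.fderiv ℝ)
      (hc.continuous_fderiv (by simp))]
    rfl
  have hm : (S ⋆[ContinuousLinearMap.mul ℝ ℂ, volume] radialBump ε) = mollify S ε := rfl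
  rw [hm] at h1
  rw [differentiableAt_complex_iff_differentiableAt_real]
  refine ⟨h1.differentiableAt, ?_⟩
  have hint : ∀ v, Integrable fun ζ => S ζ * fderiv ℝ (radialBump ε) (z - ζ) v := by
    intro v
    have hcv : Continuous fun w => fderiv ℝ (radialBump ε) w v :=
      (hc.continuous_fderiv (by simp)).clm_apply continuous_const
    obtain ⟨K, hK⟩ := (hcs.fderiv_apply ℝ v).exists_bound_of_continuous hcv
    exact hS.mul_bdd (hcv.comp (by fun_prop)).aestronglyMeasurable
      (Eventually.of_forall fun ζ => hK _)
  have h3 := integral_mul_dbar_sub_eq_zero hw hc (fun w hw => radialBump_eq_zero hε hw) hz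
  have h4 : ∫ ζ, (S ζ * fderiv ℝ (radialBump ε) (z - ζ) 1 +
      I * (S ζ * fderiv ℝ (radialBump ε) (z - ζ) I)) = 0 := by
    rw [← h3]
    refine integral_congr_ae (Eventually.of_forall fun ζ => ?_)
    simp only [dbar]
    ring
  rw [integral_add (hint 1) ((hint I).const_mul I), integral_const_mul, ← h2, ← h2] at h4
  rw [h1.fderiv, smul_eq_mul]
  linear_combination (-I) * h4 + ((S ⋆[(ContinuousLinearMap.mul ℝ ℂ).precompR ℂ, volume]
    fderiv ℝ (radialBump ε)) z I) * Complex.I_sq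

lemma ae_tendsto_mollify : ∀ᵐ z, Tendsto (fun n : ℕ => mollify S (1 / ((n : ℝ) + 1)) z) atTop
    (𝓝 (S z)) := by
  obtain ⟨K, hK0, hK⟩ := exists_norm_radialBump_le
  have hlim : Tendsto (fun n : ℕ => 1 / ((n : ℝ) + 1)) atTop (𝓝[>] 0) :=
    tendsto_nhdsWithin_iff.2 ⟨tendsto_one_div_add_atTop_nhds_zero_nat,
      Eventually.of_forall fun n => Set.mem_Ioi.2 (by positivity)⟩
  filter_upwards [IsUnifLocDoublingMeasure.ae_tendsto_average_norm_sub (volume : Measure ℂ)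
    hS.locallyIntegrable 1] with z hz
  have h1 := hz (fun _ => z) _ hlim (Eventually.of_forall fun n => by
    rw [one_mul]; exact Metric.mem_closedBall_self (by positivity))
  have h2 := h1.const_mul (Real.pi * K)
  rw [mul_zero] at h2
  rw [tendsto_iff_norm_sub_tendsto_zero]
  refine squeeze_zero (fun _ => norm_nonneg _) (fun n => ?_) h2
  set ε : ℝ := 1 / ((n : ℝ) + 1)
  have hε : 0 < ε := by positivity
  have hone : ∫ ζ, radialBump ε (z - ζ) = 1 := by
    rw [integral_sub_left_eq_self (radialBump ε) volume z, integral_radialBump hε]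
  have hbi : Integrable fun ζ => radialBump ε (z - ζ) := by
    refine Integrable.of_integral_ne_zero ?_
    rw [hone]; exact one_ne_zero
  have e1 : mollify S ε z - S z = ∫ ζ, (S ζ - S z) * radialBump ε (z - ζ) := by
    simp only [sub_mul]
    rw [integral_sub (integrable_mul_radialBump hS hε z) (hbi.const_mul _), integral_const_mul,
      hone, mul_one, mollify]
  have e2 : ∫ ζ, (S ζ - S z) * radialBump ε (z - ζ) =
      ∫ ζ in Metric.closedBall z ε, (S ζ - S z) * radialBump ε (z - ζ) := by
    refine (setIntegral_eq_integral_of_forall_compl_eq_zero fun ζ hζ => ?_).symm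
    rw [Metric.mem_closedBall, dist_comm, dist_eq_norm, not_le] at hζ
    rw [radialBump_eq_zero hε hζ.le, mul_zero]
  have e3 : IntegrableOn (fun ζ => ‖S ζ - S z‖) (Metric.closedBall z ε) :=
    (hS.integrableOn.sub (integrableOn_const measure_closedBall_lt_top.ne)).norm
  have e4 : ‖∫ ζ in Metric.closedBall z ε, (S ζ - S z) * radialBump ε (z - ζ)‖ ≤
      ∫ ζ in Metric.closedBall z ε, ((ε ^ 2)⁻¹ * K) * ‖S ζ - S z‖ := by
    refine norm_integral_le_of_norm_le (e3.const_mul _) (Eventually.of_forall fun ζ => ?_)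
    rw [norm_mul, mul_comm]
    gcongr
    exact hK ε hε _
  rw [e1, e2]
  refine e4.trans (le_of_eq ?_)
  rw [integral_const_mul, setAverage_eq, Measure.real, Complex.volume_closedBall, smul_eq_mul]
  simp only [ENNReal.toReal_mul, ENNReal.toReal_pow, ENNReal.toReal_ofReal hε.le,
    ENNReal.coe_toReal, NNReal.coe_real_pi]
  have := Real.pi_pos.ne'
  field_simp

include hw in
/-- **Weyl's lemma**: an integrable function that is weakly holomorphic on the open unit disc is
almost everywhere equal to a holomorphic function there. -/
lemma weyl : ∃ h : ℂ → ℂ, DifferentiableOn ℂ h (Metric.ball 0 1) ∧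
    ∀ᵐ z, z ∈ Metric.ball (0 : ℂ) 1 → S z = h z := by
  -- the mollification at scale `ε` is independent of `ε < 1 - |z|`; take the midpoint
  refine ⟨fun z => mollify S ((1 - ‖z‖) / 2) z, fun z₀ hz₀ => ?_, ?_⟩
  · rw [mem_ball_zero_iff] at hz₀
    have hε : 0 < (1 - ‖z₀‖) / 2 := by linarith
    refine ((differentiableAt_mollify hS hw hε (by linarith)).congr_of_eventuallyEq
      ?_).differentiableWithinAt
    have hev : ∀ᶠ z in 𝓝 z₀, ‖z‖ < 1 - (1 - ‖z₀‖) / 2 :=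
      continuous_norm.continuousAt.eventually_lt continuousAt_const (by linarith)
    filter_upwards [hev] with z hz
    exact mollify_eq hS hw (by linarith) hε (by linarith) (by linarith)
  · filter_upwards [ae_tendsto_mollify hS] with z hz hzb
    rw [mem_ball_zero_iff] at hzb
    refine tendsto_nhds_unique hz (tendsto_const_nhds.congr' ?_)
    have hev : ∀ᶠ n : ℕ in atTop, 1 / ((n : ℝ) + 1) < 1 - ‖z‖ :=
      tendsto_one_div_add_atTop_nhds_zero_nat.eventually_lt_const (by linarith)
    filter_upwards [hev] with n hn
    exact mollify_eq hS hw (by linarith) (by positivity) (by linarith) (by linarith)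

end weyl

/-! ### The orthogonal decompositions `L²(M) = ker ∂̄ ⊕ ∂H¹₀` and `L²(M) = ker ∂ ⊕ ∂̄H¹₀` -/

lemma exists_holo_of_weak {s : ℂ → ℂ} (hs : Integrable s volM)
    (hw : ∀ φ, IsTest φ → ∫ z, s z * dbar φ z ∂volM = 0) :
    ∃ h : ℂ → ℂ, DifferentiableOn ℂ h (Metric.ball 0 1) ∧ s =ᵐ[volM] h := by
  have hS : Integrable (disc.indicator s) := (integrable_indicator_iff measurableSet_disc).2 hs
  obtain ⟨h, hd, hh⟩ := weyl hS fun φ hφ => by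
    rw [← hw φ hφ, volM, ← integral_indicator measurableSet_disc]
    simp only [← Set.indicator_mul_left]
  refine ⟨h, hd, ?_⟩
  have hsph : ∀ᵐ z : ℂ, z ∉ Metric.sphere (0 : ℂ) 1 :=
    measure_eq_zero_iff_ae_notMem.1 (Measure.addHaar_sphere volume 0 1)
  rw [volM, Filter.EventuallyEq, ae_restrict_iff' measurableSet_disc]
  filter_upwards [hh, hsph] with z h1 h2 h3
  rw [← h1, Set.indicator_of_mem h3]
  rw [disc, mem_closedBall_zero_iff] at h3
  rw [mem_sphere_zero_iff_norm] at h2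
  rw [mem_ball_zero_iff]
  exact lt_of_le_of_ne h3 h2

lemma inner_wirt_test {c : ℂ} {φ : ℂ → ℂ} (hφ : IsTest φ) (s : L2M) :
    ⟪wirt c (hφ.toL2, (hφ.fderiv_apply 1).toL2, (hφ.fderiv_apply I).toL2), s⟫_ℂ =
      1 / 2 * ∫ z, s z * conj (fderiv ℝ φ z 1 + c * fderiv ℝ φ z I) ∂volM := by
  rw [L2.inner_def, ← integral_const_mul]
  refine integral_congr_ae ?_
  filter_upwards [coeFn_wirt c (hφ.toL2, (hφ.fderiv_apply 1).toL2, (hφ.fderiv_apply I).toL2),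
    (hφ.fderiv_apply 1).coeFn_toL2, (hφ.fderiv_apply I).coeFn_toL2] with z h1 h2 h3
  rw [h1, h2, h3, RCLike.inner_apply, map_mul]
  simp only [one_div, map_inv₀, map_ofNat]
  ring

lemma isHolo_of_orthogonal {s : L2M} (h : ∀ t ∈ H10, ⟪wirt (-I) t, s⟫_ℂ = 0) : IsHolo s := by
  refine exists_holo_of_weak ((Lp.memLp s).integrable (by norm_num)) fun φ hφ => ?_
  have h1 := h _ (test_mem_H10 hφ.star)
  rw [inner_wirt_test] at h1
  rw [← (mul_eq_zero.1 h1).resolve_left (by norm_num)]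
  refine integral_congr_ae (Eventually.of_forall fun z => ?_)
  simp only [hφ.fderiv_star, dbar, map_add, map_mul, map_neg, conj_conj, conj_I, neg_neg]

lemma isAntiholo_of_orthogonal {s : L2M} (h : ∀ t ∈ H10, ⟪wirt I t, s⟫_ℂ = 0) : IsAntiholo s := by
  have hs : Integrable (fun z => conj (s z)) volM :=
    Complex.conjCLE.toContinuousLinearMap.integrable_comp ((Lp.memLp s).integrable (by norm_num))
  obtain ⟨g, hg, hsg⟩ := exists_holo_of_weak hs fun φ hφ => by
    have h1 := h _ (test_mem_H10 hφ)
    rw [inner_wirt_test] at h1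
    have h2 := congrArg conj ((mul_eq_zero.1 h1).resolve_left (by norm_num))
    rw [← integral_conj, map_zero] at h2
    rw [← h2]
    refine integral_congr_ae (Eventually.of_forall fun z => ?_)
    simp only [map_mul, conj_conj, dbar]
  refine ⟨g, hg, ?_⟩
  filter_upwards [hsg] with z hz
  rw [← hz, conj_conj]

lemma norm_le_norm_wirt {c : ℂ} (hc : c = I ∨ c = -I) {t : L2M × L2M × L2M} (ht : t ∈ H10) :
    ‖t‖ ≤ (2 + 2 * Real.sqrt poincareConst) * ‖wirt c t‖ := by
  have h1 := norm_wirt_sq hc ht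
  have h2 := norm_sq_le_poincareConst ht
  rw [← h1] at h2
  rw [gradSq] at h1
  have hs := Real.sqrt_nonneg poincareConst
  have hs2 := Real.sq_sqrt poincareConst_nonneg
  have hw := norm_nonneg (wirt c t)
  have e0 : ‖t.1‖ ≤ 2 * Real.sqrt poincareConst * ‖wirt c t‖ := by
    refine abs_le_of_sq_le_sq' ?_ (by positivity) |>.2
    rw [mul_pow, mul_pow, hs2]; linarith
  have e1 : ‖t.2.1‖ ≤ 2 * ‖wirt c t‖ := by
    refine abs_le_of_sq_le_sq' ?_ (by positivity) |>.2
    nlinarith [sq_nonneg ‖t.2.2‖]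
  have e2 : ‖t.2.2‖ ≤ 2 * ‖wirt c t‖ := by
    refine abs_le_of_sq_le_sq' ?_ (by positivity) |>.2
    nlinarith [sq_nonneg ‖t.2.1‖]
  have e3 : 0 ≤ Real.sqrt poincareConst * ‖wirt c t‖ := mul_nonneg hs hw
  rw [Prod.norm_def, Prod.norm_def]
  refine max_le ?_ (max_le ?_ ?_) <;> nlinarith

/-- The Dirichlet-type problem behind the decompositions: every `p ∈ L²(M)` is, linearly in `p`,
the sum of some `wirt c t`, `t ∈ H¹₀`, and a function orthogonal to all of these. The range of
`wirt c` on `H¹₀` is closed by the Poincaré inequality. -/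
lemma exists_potential {c : ℂ} (hc : c = I ∨ c = -I) :
    ∃ W : L2M →ₗ[ℂ] L2M × L2M × L2M, (∀ p, W p ∈ H10) ∧
      ∀ p, ∀ t ∈ H10, ⟪wirt c t, p - wirt c (W p)⟫_ℂ = 0 := by
  set D : H10 →L[ℂ] L2M := (wirt c).comp H10.subtypeL
  have : CompleteSpace H10 := isClosed_H10.completeSpace_coe
  have hK : 0 ≤ 2 + 2 * Real.sqrt poincareConst := by positivity
  have hD : AntilipschitzWith (⟨2 + 2 * Real.sqrt poincareConst, hK⟩ : NNReal) D :=
    ContinuousLinearMap.antilipschitz_of_bound D fun t => norm_le_norm_wirt hc t.2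
  have hinj : Function.Injective (D : H10 →ₗ[ℂ] L2M) := hD.injective
  have hcl : IsClosed (Set.range D) := hD.isClosed_range D.uniformContinuous
  have hcl' : IsClosed ((LinearMap.range (D : H10 →ₗ[ℂ] L2M) : Submodule ℂ L2M) : Set L2M) := by
    rw [LinearMap.coe_range]; exact hcl
  have : CompleteSpace (LinearMap.range (D : H10 →ₗ[ℂ] L2M)) := hcl'.completeSpace_coe
  set R := LinearMap.range (D : H10 →ₗ[ℂ] L2M)
  refine ⟨H10.subtype ∘ₗ (LinearEquiv.ofInjective _ hinj).symm.toLinearMap ∘ₗ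
    R.orthogonalProjectionOnto.toLinearMap, fun p => Submodule.coe_mem _, fun p t ht => ?_⟩
  have h1 : wirt c ((LinearEquiv.ofInjective _ hinj).symm (R.orthogonalProjectionOnto p) : H10) =
      R.orthogonalProjectionOnto p :=
    congrArg Subtype.val ((LinearEquiv.ofInjective _ hinj).apply_symm_apply
      (R.orthogonalProjectionOnto p))
  change ⟪wirt c t, p - wirt c ((LinearEquiv.ofInjective _ hinj).symm
    (R.orthogonalProjectionOnto p) : H10)⟫_ℂ = 0
  rw [h1]
  exact (Submodule.mem_orthogonal _ _).1 (R.sub_starProjection_mem_orthogonal p) _ ⟨⟨t, ht⟩, rfl⟩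

/-- `p ↦ w`, where `w ∈ H¹₀(M)` and `p - ∂w` is holomorphic. -/
def potD : L2M →ₗ[ℂ] L2M × L2M × L2M := (exists_potential (c := -I) (Or.inr rfl)).choose

/-- `q ↦ v`, where `v ∈ H¹₀(M)` and `q - ∂̄v` is antiholomorphic. -/
def potDbar : L2M →ₗ[ℂ] L2M × L2M × L2M := (exists_potential (c := I) (Or.inl rfl)).choose

lemma potD_mem (p : L2M) : potD p ∈ H10 :=
  (exists_potential (c := -I) (Or.inr rfl)).choose_spec.1 p

lemma potDbar_mem (q : L2M) : potDbar q ∈ H10 :=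
  (exists_potential (c := I) (Or.inl rfl)).choose_spec.1 q

lemma isHolo_sub_potD (p : L2M) : IsHolo (p - wirt (-I) (potD p)) :=
  isHolo_of_orthogonal ((exists_potential (c := -I) (Or.inr rfl)).choose_spec.2 p)

lemma isAntiholo_sub_potDbar (q : L2M) : IsAntiholo (q - wirt I (potDbar q)) :=
  isAntiholo_of_orthogonal ((exists_potential (c := I) (Or.inl rfl)).choose_spec.2 q)

lemma norm_sub_potD_sq (p : L2M) (t : L2M × L2M × L2M) (ht : t ∈ H10) :
    ‖p - wirt (-I) (potD p) + wirt (-I) t‖ ^ 2 =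
      ‖p - wirt (-I) (potD p)‖ ^ 2 + ‖wirt (-I) t‖ ^ 2 := by
  have h := (exists_potential (c := -I) (Or.inr rfl)).choose_spec.2 p t ht
  have h1 := norm_add_sq_eq_norm_sq_add_norm_sq_of_inner_eq_zero _ _ h
  rw [add_comm, sq, sq, sq, add_comm (_ * _)]
  exact h1

lemma norm_sub_potDbar_sq (q : L2M) (t : L2M × L2M × L2M) (ht : t ∈ H10) :
    ‖q - wirt I (potDbar q) + wirt I t‖ ^ 2 =
      ‖q - wirt I (potDbar q)‖ ^ 2 + ‖wirt I t‖ ^ 2 := by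
  have h := (exists_potential (c := I) (Or.inl rfl)).choose_spec.2 q t ht
  have h1 := norm_add_sq_eq_norm_sq_add_norm_sq_of_inner_eq_zero _ _ h
  rw [add_comm, sq, sq, sq, add_comm (_ * _)]
  exact h1

/-! ### Reduction of the degree, and the estimates -/

section reduction

variable {a : ℂ → ℂ} (ha : ContinuousOn a disc)

/-- Subtraction of a function `(X + a)u`, with `u` of order `k - 1` vanishing on the boundary,
that makes the component of order `k ≥ 2` solenoidal. For `k = 1`, only one function `u` of order
zero is available, and it is the mean of the two potentials. For `k = 0` nothing is subtracted. -/
def gauge : ℕ → L2SM →ₗ[ℂ] L2SM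
  | 0 => LinearMap.id
  | 1 => LinearMap.id - (transport ha 0).toLinearMap ∘ₗ
      ((1 / 2 : ℂ) • (potD ∘ₗ (coeff 1).toLinearMap + potDbar ∘ₗ (coeff (-1)).toLinearMap))
  | k + 2 => LinearMap.id -
      (transport ha (k + 1)).toLinearMap ∘ₗ potD ∘ₗ (coeff (k + 2)).toLinearMap -
      (transport ha (-(k + 1))).toLinearMap ∘ₗ potDbar ∘ₗ (coeff (-(k + 2))).toLinearMap

/-- The successive reductions of the components of order `k, k - 1, …, 1`, in this order. -/
def reduce : ℕ → L2SM →ₗ[ℂ] L2SM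
  | 0 => LinearMap.id
  | k + 1 => reduce k ∘ₗ gauge ha (k + 1)

/-- The mean of the two potentials of the component of order one. -/
def meanPot (f : L2SM) : L2M × L2M × L2M :=
  (1 / 2 : ℂ) • (potD (coeff 1 f) + potDbar (coeff (-1) f))

lemma meanPot_mem (f : L2SM) : meanPot f ∈ H10 :=
  H10.smul_mem _ (H10.add_mem (potD_mem _) (potDbar_mem _))

lemma gauge_one_apply (f : L2SM) : gauge ha 1 f = f - transport ha 0 (meanPot f) := rfl

lemma gauge_add_two_apply (k : ℕ) (f : L2SM) : gauge ha (k + 2) f =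
    f - transport ha (k + 1) (potD (coeff (k + 2) f)) -
      transport ha (-(k + 1)) (potDbar (coeff (-(k + 2)) f)) := rfl

lemma sub_gauge_mem (k : ℕ) (f : L2SM) : f - gauge ha k f ∈ xrayKer ha := by
  match k with
  | 0 =>
    have : f - gauge ha 0 f = 0 := sub_self f
    rw [this]; exact Submodule.zero_mem _
  | 1 =>
    rw [gauge_one_apply, sub_sub_cancel]
    exact transport_mem_xrayKer ha _ (meanPot_mem f)
  | k + 2 =>
    rw [gauge_add_two_apply, sub_sub, sub_sub_cancel]
    exact Submodule.add_mem _ (transport_mem_xrayKer ha _ (potD_mem _))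
      (transport_mem_xrayKer ha _ (potDbar_mem _))

lemma sub_reduce_mem (k : ℕ) (f : L2SM) : f - reduce ha k f ∈ xrayKer ha := by
  induction k generalizing f with
  | zero =>
    have : f - reduce ha 0 f = 0 := sub_self f
    rw [this]; exact Submodule.zero_mem _
  | succ k ih =>
    have h := Submodule.add_mem _ (sub_gauge_mem ha (k + 1) f) (ih (gauge ha (k + 1) f))
    rwa [sub_add_sub_cancel] at h

lemma transport_mem_L2Deg {n : ℤ} {m : ℕ} (hn : n.natAbs + 1 ≤ m) (t : L2M × L2M × L2M) :
    transport ha n t ∈ L2Deg m :=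
  Submodule.add_mem _ (Submodule.add_mem _ (mode_mem_L2Deg (by omega) _)
    (mode_mem_L2Deg (by omega) _)) (mode_mem_L2Deg (by omega) _)

lemma gauge_mem_L2Deg {k m : ℕ} (hk : k ≤ m) {f : L2SM} (hf : f ∈ L2Deg m) :
    gauge ha k f ∈ L2Deg m := by
  match k with
  | 0 => exact hf
  | 1 => exact Submodule.sub_mem _ hf (transport_mem_L2Deg ha (by simpa using hk) _)
  | k + 2 =>
    exact Submodule.sub_mem _ (Submodule.sub_mem _ hf (transport_mem_L2Deg ha (by omega) _))
      (transport_mem_L2Deg ha (by omega) _)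

lemma reduce_mem_L2Deg {k m : ℕ} (hk : k ≤ m) {f : L2SM} (hf : f ∈ L2Deg m) :
    reduce ha k f ∈ L2Deg m := by
  induction k generalizing f with
  | zero => exact hf
  | succ k ih => exact ih (by omega) (gauge_mem_L2Deg ha hk hf)

lemma coeff_transport (n j : ℤ) (t : L2M × L2M × L2M) : coeff n (transport ha j t) =
    (if n = j + 1 then wirt (-I) t else 0) + (if n = j - 1 then wirt I t else 0) +
      (if n = j then mulA ha t.1 else 0) := by
  rw [transport_apply, map_add, map_add, coeff_mode, coeff_mode, coeff_mode]

lemma coeff_gauge_of_lt {k : ℕ} {n : ℤ} (hn : k < n.natAbs) (f : L2SM) :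
    coeff n (gauge ha k f) = coeff n f := by
  match k with
  | 0 => rfl
  | 1 =>
    rw [gauge_one_apply, map_sub, coeff_transport, if_neg (by omega), if_neg (by omega),
      if_neg (by omega)]
    simp
  | k + 2 =>
    rw [gauge_add_two_apply, map_sub, map_sub, coeff_transport, coeff_transport,
      if_neg (by omega), if_neg (by omega), if_neg (by omega), if_neg (by omega),
      if_neg (by omega), if_neg (by omega)]
    simp

lemma coeff_gauge_of_add_two_lt {k : ℕ} {n : ℤ} (hn : n.natAbs < k) (f : L2SM) :
    coeff n (gauge ha (k + 2) f) = coeff n f := by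
  rw [gauge_add_two_apply, map_sub, map_sub, coeff_transport, coeff_transport,
    if_neg (by omega), if_neg (by omega), if_neg (by omega), if_neg (by omega),
    if_neg (by omega), if_neg (by omega)]
  simp

lemma coeff_reduce_of_lt {k : ℕ} {n : ℤ} (hn : k < n.natAbs) (f : L2SM) :
    coeff n (reduce ha k f) = coeff n f := by
  induction k generalizing f with
  | zero => rfl
  | succ k ih =>
    exact (ih (by omega) (gauge ha (k + 1) f)).trans (coeff_gauge_of_lt ha hn f)

lemma coeff_gauge_top (k : ℕ) (f : L2SM) : coeff (k + 2) (gauge ha (k + 2) f) =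
    coeff (k + 2) f - wirt (-I) (potD (coeff (k + 2) f)) := by
  rw [gauge_add_two_apply, map_sub, map_sub, coeff_transport, coeff_transport,
    if_pos (by omega), if_neg (by omega), if_neg (by omega), if_neg (by omega),
    if_neg (by omega), if_neg (by omega)]
  simp

lemma coeff_gauge_neg_top (k : ℕ) (f : L2SM) : coeff (-(k + 2)) (gauge ha (k + 2) f) =
    coeff (-(k + 2)) f - wirt I (potDbar (coeff (-(k + 2)) f)) := by
  rw [gauge_add_two_apply, map_sub, map_sub, coeff_transport, coeff_transport,
    if_neg (by omega), if_neg (by omega), if_neg (by omega), if_neg (by omega),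
    if_pos (by omega), if_neg (by omega)]
  simp

lemma coeff_gauge_mid (k : ℕ) (f : L2SM) : coeff (k + 1) (gauge ha (k + 2) f) =
    coeff (k + 1) f - mulA ha (potD (coeff (k + 2) f)).1 := by
  rw [gauge_add_two_apply, map_sub, map_sub, coeff_transport, coeff_transport,
    if_neg (by omega), if_neg (by omega), if_pos (by omega), if_neg (by omega),
    if_neg (by omega), if_neg (by omega)]
  simp

lemma coeff_gauge_neg_mid (k : ℕ) (f : L2SM) : coeff (-(k + 1)) (gauge ha (k + 2) f) =
    coeff (-(k + 1)) f - mulA ha (potDbar (coeff (-(k + 2)) f)).1 := by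
  rw [gauge_add_two_apply, map_sub, map_sub, coeff_transport, coeff_transport,
    if_neg (by omega), if_neg (by omega), if_neg (by omega), if_neg (by omega),
    if_neg (by omega), if_pos (by omega)]
  simp

lemma coeff_gauge_bot {k : ℕ} (hk : k ≠ 0) (f : L2SM) : coeff k (gauge ha (k + 2) f) =
    coeff k f - wirt I (potD (coeff (k + 2) f)) := by
  rw [gauge_add_two_apply, map_sub, map_sub, coeff_transport, coeff_transport,
    if_neg (by omega), if_pos (by omega), if_neg (by omega), if_neg (by omega),
    if_neg (by omega), if_neg (by omega)]
  simp

lemma coeff_gauge_neg_bot {k : ℕ} (hk : k ≠ 0) (f : L2SM) : coeff (-k) (gauge ha (k + 2) f) =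
    coeff (-k) f - wirt (-I) (potDbar (coeff (-(k + 2)) f)) := by
  rw [gauge_add_two_apply, map_sub, map_sub, coeff_transport, coeff_transport,
    if_neg (by omega), if_neg (by omega), if_neg (by omega), if_pos (by omega),
    if_neg (by omega), if_neg (by omega)]
  simp

lemma coeff_zero_gauge_two (f : L2SM) : coeff 0 (gauge ha 2 f) =
    coeff 0 f - wirt I (potD (coeff 2 f)) - wirt (-I) (potDbar (coeff (-2) f)) := by
  have h := gauge_add_two_apply ha 0 f
  simp only [CharP.cast_eq_zero, zero_add] at h
  rw [h, map_sub, map_sub, coeff_transport, coeff_transport,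
    if_neg (by omega), if_pos (by omega), if_neg (by omega), if_pos (by omega),
    if_neg (by omega), if_neg (by omega)]
  simp

lemma coeff_one_gauge_one (f : L2SM) : coeff 1 (gauge ha 1 f) =
    coeff 1 f - wirt (-I) (meanPot f) := by
  rw [gauge_one_apply, map_sub, coeff_transport, if_pos (by omega), if_neg (by omega),
    if_neg (by omega)]
  simp

lemma coeff_neg_one_gauge_one (f : L2SM) : coeff (-1) (gauge ha 1 f) =
    coeff (-1) f - wirt I (meanPot f) := by
  rw [gauge_one_apply, map_sub, coeff_transport, if_neg (by omega), if_pos (by omega),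
    if_neg (by omega)]
  simp

lemma coeff_zero_gauge_one (f : L2SM) : coeff 0 (gauge ha 1 f) =
    coeff 0 f - mulA ha (meanPot f).1 := by
  rw [gauge_one_apply, map_sub, coeff_transport, if_neg (by omega), if_neg (by omega),
    if_pos (by omega)]
  simp

lemma norm_sub_sq_le {E : Type*} [SeminormedAddCommGroup E] (x y : E) :
    ‖x - y‖ ^ 2 ≤ 2 * ‖x‖ ^ 2 + 2 * ‖y‖ ^ 2 := by
  have h := norm_sub_le x y
  have h0 := norm_nonneg (x - y)
  nlinarith [sq_nonneg (‖x‖ - ‖y‖)]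

lemma norm_mulA_sq_le {c : ℂ} (hc : c = I ∨ c = -I) {t : L2M × L2M × L2M} (ht : t ∈ H10) :
    ‖mulA ha t.1‖ ^ 2 ≤ 4 * supM a ^ 2 * poincareConst * ‖wirt c t‖ ^ 2 := by
  have h1 := norm_mulA_le ha t.1
  have h2 := pow_le_pow_left₀ (norm_nonneg _) h1 2
  have h3 := norm_sq_le_poincareConst ht
  rw [← norm_wirt_sq hc ht] at h3
  rw [mul_pow] at h2
  have h4 := mul_le_mul_of_nonneg_left h3 (sq_nonneg (supM a))
  linarith

lemma norm_wirt_I_eq {t : L2M × L2M × L2M} (ht : t ∈ H10) :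
    ‖wirt I t‖ ^ 2 = ‖wirt (-I) t‖ ^ 2 := by
  have h1 := norm_wirt_sq (Or.inl rfl) ht
  have h2 := norm_wirt_sq (Or.inr rfl) ht
  linarith

lemma energy_zero (f : L2SM) : energy 0 f = 2 * Real.pi * ‖coeff 0 f‖ ^ 2 := by
  simp [energy]

lemma energy_one (f : L2SM) :
    energy 1 f = 2 * Real.pi * (‖coeff 1 f‖ ^ 2 + ‖coeff (-1) f‖ ^ 2) := by
  simp [energy]

lemma energy_of_ne_zero {k : ℕ} (hk : k ≠ 0) (f : L2SM) :
    energy k f = 2 * Real.pi * (‖coeff k f‖ ^ 2 + ‖coeff (-k) f‖ ^ 2) := by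
  simp [energy, hk]

lemma energy_add_one (k : ℕ) (f : L2SM) :
    energy (k + 1) f = 2 * Real.pi * (‖coeff (k + 1) f‖ ^ 2 + ‖coeff (-(k + 1)) f‖ ^ 2) := by
  rw [energy_of_ne_zero (by omega)]; push_cast; rfl

lemma energy_add_two (k : ℕ) (f : L2SM) :
    energy (k + 2) f = 2 * Real.pi * (‖coeff (k + 2) f‖ ^ 2 + ‖coeff (-(k + 2)) f‖ ^ 2) := by
  rw [energy_of_ne_zero (by omega)]; push_cast; rfl

lemma energy_congr {k : ℕ} {f g : L2SM} (h : ∀ n : ℤ, n.natAbs = k → coeff n f = coeff n g) :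
    energy k f = energy k g := by
  rw [energy, energy, h k (by simp), h (-k) (by simp)]

/-- The squared norm of the part of the component of order `k` that a reduction removes, for
`k ≥ 2`. -/
def removed (k : ℕ) (f : L2SM) : ℝ :=
  2 * Real.pi * (‖wirt (-I) (potD (coeff k f))‖ ^ 2 + ‖wirt I (potDbar (coeff (-k) f))‖ ^ 2)

lemma removed_nonneg (k : ℕ) (f : L2SM) : 0 ≤ removed k f := by
  unfold removed; have := Real.pi_pos; positivity

lemma removed_add_two (k : ℕ) (f : L2SM) : removed (k + 2) f =
    2 * Real.pi * (‖wirt (-I) (potD (coeff (k + 2) f))‖ ^ 2 +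
      ‖wirt I (potDbar (coeff (-(k + 2)) f))‖ ^ 2) := by
  rw [removed]; push_cast; rfl

lemma energy_gauge_top (k : ℕ) (f : L2SM) :
    energy (k + 2) (gauge ha (k + 2) f) + removed (k + 2) f = energy (k + 2) f := by
  rw [energy_add_two, energy_add_two, removed_add_two, coeff_gauge_top, coeff_gauge_neg_top]
  have h1 := norm_sub_potD_sq (coeff (k + 2) f) _ (potD_mem (coeff (k + 2) f))
  have h2 := norm_sub_potDbar_sq (coeff (-(k + 2)) f) _ (potDbar_mem (coeff (-(k + 2)) f))
  rw [sub_add_cancel] at h1 h2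
  rw [h1, h2]
  ring

lemma energy_gauge_mid (k : ℕ) (f : L2SM) : energy (k + 1) (gauge ha (k + 2) f) ≤
    2 * energy (k + 1) f + 8 * supM a ^ 2 * poincareConst * removed (k + 2) f := by
  rw [energy_add_one, energy_add_one, removed_add_two, coeff_gauge_mid, coeff_gauge_neg_mid]
  set w := potD (coeff (k + 2) f)
  set v := potDbar (coeff (-(k + 2)) f)
  have h1 := norm_sub_sq_le (coeff (k + 1) f) (mulA ha w.1)
  have h2 := norm_sub_sq_le (coeff (-(k + 1)) f) (mulA ha v.1)
  have h3 := norm_mulA_sq_le ha (c := -I) (Or.inr rfl) (potD_mem (coeff (k + 2) f))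
  have h4 := norm_mulA_sq_le ha (c := I) (Or.inl rfl) (potDbar_mem (coeff (-(k + 2)) f))
  have h5 : ‖coeff (k + 1) f - mulA ha w.1‖ ^ 2 + ‖coeff (-(k + 1)) f - mulA ha v.1‖ ^ 2 ≤
      2 * (‖coeff (k + 1) f‖ ^ 2 + ‖coeff (-(k + 1)) f‖ ^ 2) +
      8 * supM a ^ 2 * poincareConst * (‖wirt (-I) w‖ ^ 2 + ‖wirt I v‖ ^ 2) := by linarith
  have h6 := mul_le_mul_of_nonneg_left h5 Real.two_pi_pos.le
  linarith

lemma energy_gauge_bot {k : ℕ} (hk : k ≠ 0) (f : L2SM) : energy k (gauge ha (k + 2) f) ≤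
    2 * energy k f + 2 * removed (k + 2) f := by
  rw [energy_of_ne_zero hk, energy_of_ne_zero hk, removed_add_two, coeff_gauge_bot ha hk,
    coeff_gauge_neg_bot ha hk]
  set w := potD (coeff (k + 2) f)
  set v := potDbar (coeff (-(k + 2)) f)
  have h1 := norm_sub_sq_le (coeff k f) (wirt I w)
  have h2 := norm_sub_sq_le (coeff (-k) f) (wirt (-I) v)
  rw [norm_wirt_I_eq (potD_mem _)] at h1
  rw [← norm_wirt_I_eq (potDbar_mem _)] at h2
  have h6 := mul_le_mul_of_nonneg_left (add_le_add h1 h2) Real.two_pi_pos.le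
  linarith

/-- For `k = 2` both exponentials `e^{±i(k-2)θ}` coincide, at the cost of a factor two. -/
lemma energy_zero_gauge_two (f : L2SM) : energy 0 (gauge ha 2 f) ≤
    2 * energy 0 f + 4 * removed 2 f := by
  rw [energy_zero, energy_zero, removed, coeff_zero_gauge_two, Nat.cast_ofNat]
  set w := potD (coeff 2 f)
  set v := potDbar (coeff (-2) f)
  have h1 := norm_sub_sq_le (coeff 0 f) (wirt I w - -wirt (-I) v)
  have h2 := norm_sub_sq_le (wirt I w) (-wirt (-I) v)
  rw [sub_neg_eq_add] at h1 h2
  rw [norm_neg, norm_wirt_I_eq (potD_mem _), ← norm_wirt_I_eq (potDbar_mem _)] at h2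
  rw [sub_sub]
  have h3 := mul_le_mul_of_nonneg_left h1 Real.two_pi_pos.le
  have h4 := mul_le_mul_of_nonneg_left h2 Real.two_pi_pos.le
  linarith

lemma energy_gauge_one (f : L2SM) :
    energy 1 (gauge ha 1 f) + 4 * Real.pi * ‖wirt I (meanPot f)‖ ^ 2 = energy 1 f := by
  set w := potD (coeff 1 f)
  set v := potDbar (coeff (-1) f)
  have hw : w ∈ H10 := potD_mem _
  have hv : v ∈ H10 := potDbar_mem _
  set d : L2M × L2M × L2M := (1 / 2 : ℂ) • (w - v)
  have hd : d ∈ H10 := H10.smul_mem _ (H10.sub_mem hw hv)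
  have hmean : meanPot f = (1 / 2 : ℂ) • (w + v) := rfl
  have hwd : w = meanPot f + d := by rw [hmean]; module
  have hvd : v = meanPot f - d := by rw [hmean]; module
  have e1 : coeff 1 f - wirt (-I) (meanPot f) = coeff 1 f - wirt (-I) w + wirt (-I) d := by
    rw [hwd, map_add]; abel
  have e2 : coeff (-1) f - wirt I (meanPot f) = coeff (-1) f - wirt I v + wirt I (-d) := by
    rw [hvd, map_sub, map_neg]; abel
  rw [energy_one, energy_one, coeff_one_gauge_one, coeff_neg_one_gauge_one, e1, e2,
    norm_sub_potD_sq _ _ hd, norm_sub_potDbar_sq _ _ (H10.neg_mem hd)]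
  have h1 := norm_sub_potD_sq (coeff 1 f) _ hw
  have h2 := norm_sub_potDbar_sq (coeff (-1) f) _ hv
  rw [sub_add_cancel] at h1 h2
  rw [h1, h2]
  -- the parallelogram law for `w = h + d` and `v = h - d`
  have h3 := parallelogram_law_with_norm ℂ (wirt I (meanPot f)) (wirt I d)
  rw [← map_add, ← map_sub, ← hwd, ← hvd] at h3
  have h4 := norm_wirt_I_eq hw
  have h5 := norm_wirt_I_eq hd
  rw [map_neg, norm_neg]
  have h6 : ‖wirt (-I) w‖ ^ 2 + ‖wirt I v‖ ^ 2 = 2 * ‖wirt I (meanPot f)‖ ^ 2 +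
      ‖wirt (-I) d‖ ^ 2 + ‖wirt I d‖ ^ 2 := by
    rw [← h4, ← h5]; linarith
  linear_combination (-(2 * Real.pi)) * h6

lemma energy_zero_gauge_one (f : L2SM) : energy 0 (gauge ha 1 f) ≤ 2 * energy 0 f +
    4 * supM a ^ 2 * poincareConst * (4 * Real.pi * ‖wirt I (meanPot f)‖ ^ 2) := by
  rw [energy_zero, energy_zero, coeff_zero_gauge_one]
  have h1 := norm_sub_sq_le (coeff 0 f) (mulA ha (meanPot f).1)
  have h2 := norm_mulA_sq_le ha (c := I) (Or.inl rfl) (meanPot_mem f)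
  have h3 := mul_le_mul_of_nonneg_left (h1.trans (add_le_add_right
    (mul_le_mul_of_nonneg_left h2 zero_le_two) _)) Real.two_pi_pos.le
  linarith

/-- The squared norm of the components of order at most `k` once these have been reduced. -/
def reducedEnergy (k : ℕ) (f : L2SM) : ℝ :=
  ∑ j ∈ Finset.range (k + 1), energy j (reduce ha k f)

lemma reducedEnergy_succ (k : ℕ) (f : L2SM) : reducedEnergy ha (k + 1) f =
    reducedEnergy ha k (gauge ha (k + 1) f) + energy (k + 1) (gauge ha (k + 1) f) := by
  rw [reducedEnergy, Finset.sum_range_succ, reducedEnergy]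
  congr 1
  exact energy_congr (f := reduce ha k (gauge ha (k + 1) f)) fun n hn =>
    coeff_reduce_of_lt ha (n := n) (by omega) _

lemma reducedEnergy_one_le (f : L2SM) : reducedEnergy ha 1 f ≤
    2 * energy 0 f + (1 + 4 * supM a ^ 2 * poincareConst) * energy 1 f := by
  have h : reducedEnergy ha 1 f = energy 0 (gauge ha 1 f) + energy 1 (gauge ha 1 f) := by
    rw [reducedEnergy_succ, reducedEnergy, Finset.sum_range_one]; rfl
  have h1 := energy_gauge_one ha f
  have h2 := energy_zero_gauge_one ha f
  have h3 : 0 ≤ energy 1 (gauge ha 1 f) := energy_nonneg _ _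
  have hA : 0 ≤ 4 * supM a ^ 2 * poincareConst := by have := poincareConst_nonneg; positivity
  have h4 : 0 ≤ Real.pi * ‖wirt I (meanPot f)‖ ^ 2 := by have := Real.pi_pos; positivity
  rw [h]
  nlinarith [mul_nonneg hA h3]

lemma four_le_stabConst (a : ℂ → ℂ) : 4 ≤ stabConst a := by
  have := poincareConst_nonneg
  unfold stabConst
  have : 0 ≤ 8 * supM a ^ 2 * poincareConst := by positivity
  linarith

lemma reducedEnergy_le (k : ℕ) (f : L2SM) : reducedEnergy ha (k + 2) f ≤
    4 * ∑ p ∈ Finset.range (k + 1), stabConst a ^ p * energy p f +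
      2 * stabConst a ^ (k + 1) * energy (k + 1) f +
      stabConst a ^ (k + 2) * energy (k + 2) f := by
  have hC := four_le_stabConst a
  have hCA : 8 * supM a ^ 2 * poincareConst = stabConst a - 4 := by unfold stabConst; ring
  set C := stabConst a
  induction k generalizing f with
  | zero =>
    have h0 := reducedEnergy_one_le ha (gauge ha 2 f)
    have h1 := energy_gauge_top ha 0 f
    have h2 := energy_gauge_mid ha 0 f
    have h3 := energy_zero_gauge_two ha f
    have hr := removed_nonneg 2 f
    have he := energy_nonneg 1 f
    have he2 := energy_nonneg 2 (gauge ha 2 f)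
    have hA : 4 * supM a ^ 2 * poincareConst = (C - 4) / 2 := by linarith
    rw [hCA] at h2
    rw [hA] at h0
    simp only [zero_add] at h1 h2
    rw [reducedEnergy_succ]
    simp only [zero_add, Finset.sum_range_one, pow_zero, pow_one, one_mul]
    rw [← h1]
    have h5 : (1 + (C - 4) / 2) * energy 1 (gauge ha 2 f) ≤
        (1 + (C - 4) / 2) * (2 * energy 1 f + (C - 4) * removed 2 f) :=
      mul_le_mul_of_nonneg_left h2 (by linarith)
    have h6 : energy 2 (gauge ha 2 f) ≤ C ^ 2 * energy 2 (gauge ha 2 f) :=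
      le_mul_of_one_le_left he2 (by nlinarith)
    have h7 : (8 + (1 + (C - 4) / 2) * (C - 4)) * removed 2 f ≤ C ^ 2 * removed 2 f :=
      mul_le_mul_of_nonneg_right (by nlinarith) hr
    change reducedEnergy ha 1 (gauge ha 2 f) + energy 2 (gauge ha 2 f) ≤ _
    nlinarith
  | succ k ih =>
    have h0 := ih (gauge ha (k + 3) f)
    have h1 := energy_gauge_top ha (k + 1) f
    have h2 := energy_gauge_mid ha (k + 1) f
    have h3 := energy_gauge_bot ha (k := k + 1) (by omega) f
    have hr := removed_nonneg (k + 3) f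
    have he3 := energy_nonneg (k + 3) (gauge ha (k + 3) f)
    have hsum : ∑ p ∈ Finset.range (k + 1), C ^ p * energy p (gauge ha (k + 3) f) =
        ∑ p ∈ Finset.range (k + 1), C ^ p * energy p f := by
      refine Finset.sum_congr rfl fun p hp => ?_
      rw [Finset.mem_range] at hp
      rw [energy_congr fun n hn => coeff_gauge_of_add_two_lt ha (k := k + 1) (by omega) f]
    rw [hCA] at h2
    rw [hsum] at h0
    rw [reducedEnergy_succ, Finset.sum_range_succ]
    change energy (k + 3) (gauge ha (k + 3) f) + removed (k + 3) f = energy (k + 3) f at h1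
    change energy (k + 2) (gauge ha (k + 3) f) ≤
      2 * energy (k + 2) f + (C - 4) * removed (k + 3) f at h2
    change energy (k + 1) (gauge ha (k + 3) f) ≤
      2 * energy (k + 1) f + 2 * removed (k + 3) f at h3
    change reducedEnergy ha (k + 2) (gauge ha (k + 3) f) + energy (k + 3) (gauge ha (k + 3) f) ≤
      4 * (∑ p ∈ Finset.range (k + 1), C ^ p * energy p f + C ^ (k + 1) * energy (k + 1) f) +
        2 * C ^ (k + 2) * energy (k + 2) f + C ^ (k + 3) * energy (k + 3) f
    rw [← h1]
    have hX : 1 ≤ C ^ (k + 1) := one_le_pow₀ (by linarith)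
    have e2 : C ^ (k + 2) = C ^ (k + 1) * C := pow_succ _ _
    have e3 : C ^ (k + 3) = C ^ (k + 1) * C ^ 2 := by ring
    rw [e2] at h0 ⊢
    rw [e3]
    set X := C ^ (k + 1)
    have g1 : 2 * X * energy (k + 1) (gauge ha (k + 3) f) ≤
        2 * X * (2 * energy (k + 1) f + 2 * removed (k + 3) f) :=
      mul_le_mul_of_nonneg_left h3 (by linarith)
    have g2 : X * C * energy (k + 2) (gauge ha (k + 3) f) ≤
        X * C * (2 * energy (k + 2) f + (C - 4) * removed (k + 3) f) :=
      mul_le_mul_of_nonneg_left h2 (by nlinarith)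
    have g3 : energy (k + 3) (gauge ha (k + 3) f) ≤
        X * C ^ 2 * energy (k + 3) (gauge ha (k + 3) f) :=
      le_mul_of_one_le_left he3 (by nlinarith)
    have g4 : 4 * X * removed (k + 3) f ≤ 4 * X * C * removed (k + 3) f :=
      mul_le_mul_of_nonneg_right (by nlinarith) hr
    nlinarith

lemma isHolo_coeff_reduce {j k : ℕ} (hjk : j + 2 ≤ k) (f : L2SM) :
    IsHolo (coeff ((j + 2 : ℕ) : ℤ) (reduce ha k f)) ∧
      IsAntiholo (coeff (-((j + 2 : ℕ) : ℤ)) (reduce ha k f)) := by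
  induction k generalizing f with
  | zero => omega
  | succ k ih =>
    rcases hjk.lt_or_eq with h | h
    · exact ih (by omega) (gauge ha (k + 1) f)
    · obtain rfl : k = j + 1 := by omega
      change IsHolo (coeff _ (reduce ha (j + 1) (gauge ha (j + 2) f))) ∧
        IsAntiholo (coeff _ (reduce ha (j + 1) (gauge ha (j + 2) f)))
      rw [coeff_reduce_of_lt ha (by omega), coeff_reduce_of_lt ha (by omega)]
      push_cast
      rw [coeff_gauge_top, coeff_gauge_neg_top]
      exact ⟨isHolo_sub_potD _, isAntiholo_sub_potDbar _⟩

lemma exists_coeff_one_reduce (k : ℕ) (f : L2SM) : ∃ (s t : L2M) (g : L2M × L2M × L2M),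
    IsHolo s ∧ IsAntiholo t ∧ g ∈ H10 ∧
      coeff 1 (reduce ha (k + 1) f) = s - I • wirt (-I) g ∧
      coeff (-1) (reduce ha (k + 1) f) = t + I • wirt I g := by
  induction k generalizing f with
  | zero =>
    -- `h = (w + v) / 2` and `g = (v - w) / (2 i)` solve `h - i g = w`, `h + i g = v`
    refine ⟨_, _, (-(I / 2)) • (potDbar (coeff (-1) f) - potD (coeff 1 f)),
      isHolo_sub_potD (coeff 1 f), isAntiholo_sub_potDbar (coeff (-1) f),
      H10.smul_mem _ (H10.sub_mem (potDbar_mem _) (potD_mem _)), ?_, ?_⟩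
    · refine (coeff_one_gauge_one ha f).trans ?_
      have hI : I * -(I / 2) = 1 / 2 := by linear_combination (-1 / 2) * Complex.I_sq
      rw [meanPot, map_smul, map_smul, smul_smul, hI, map_add, map_sub]
      module
    · refine (coeff_neg_one_gauge_one ha f).trans ?_
      have hI : I * -(I / 2) = 1 / 2 := by linear_combination (-1 / 2) * Complex.I_sq
      rw [meanPot, map_smul, map_smul, smul_smul, hI, map_add, map_sub]
      module
  | succ k ih => exact ih (gauge ha (k + 2) f)

end reduction

lemma xPerp_ae_eq (t : L2M × L2M × L2M) :
    ((mode 1 (-I • wirt (-I) t) + mode (-1) (I • wirt I t) : L2SM) : ℂ × Circ → ℂ) =ᵐ[volSM]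
      xPerp t.2.1 t.2.2 := by
  filter_upwards [Lp.coeFn_add (mode 1 (-I • wirt (-I) t)) (mode (-1) (I • wirt I t)),
    coeFn_mode 1 (-I • wirt (-I) t), coeFn_mode (-1) (I • wirt I t),
    ae_fst (Lp.coeFn_smul (-I) (wirt (-I) t)), ae_fst (Lp.coeFn_smul I (wirt I t)),
    ae_fst (coeFn_wirt (-I) t), ae_fst (coeFn_wirt I t)] with s h1 h2 h3 h4 h5 h6 h7
  rw [h1, Pi.add_apply, h2, h3, h4, h5, Pi.smul_apply, Pi.smul_apply, h6, h7, fourier_neg,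
    fourier_one_eq_dir, xPerp, smul_eq_mul, smul_eq_mul]
  set v := dir s.2
  have e1 : v = v.re + v.im * I := (Complex.re_add_im v).symm
  have e2 : conj v = v.re - v.im * I := by
    apply Complex.ext <;> simp
  rw [e2]
  nth_rewrite 1 [e1]
  linear_combination (-(v.im : ℂ) * t.2.1 s.1 + v.re * t.2.2 s.1) * Complex.I_sq

lemma coeFn_finset_sum (s : Finset ℕ) (g : ℕ → L2SM) :
    ((∑ k ∈ s, g k : L2SM) : ℂ × Circ → ℂ) =ᵐ[volSM] fun x => ∑ k ∈ s, g k x := by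
  classical
  induction s using Finset.induction_on with
  | empty =>
    filter_upwards [Lp.coeFn_zero ℂ 2 volSM] with x hx
    rw [Finset.sum_empty, hx, Finset.sum_empty, Pi.zero_apply]
  | insert k s hk ih =>
    rw [Finset.sum_insert hk]
    filter_upwards [Lp.coeFn_add (g k) (∑ k ∈ s, g k), ih] with x h1 h2
    rw [h1, Pi.add_apply, h2, Finset.sum_insert hk]

lemma mode_zero_ae_eq (p : L2M) : mode 0 p =ᵐ[volSM] fun s => p s.1 := by
  filter_upwards [coeFn_mode 0 p] with s hs
  rw [hs, fourier_zero, mul_one]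

lemma exists_normal_form {a : ℂ → ℂ} (ha : ContinuousOn a disc) {m : ℕ} {f : L2SM}
    (hf : f ∈ L2Deg m) : ∃ (g₀ gs p q : L2M) (g : ℕ → L2SM), HasH10Grad gs p q ∧
      (∀ k ∈ Finset.Icc 1 m, g k ∈ Hsol k) ∧
      (reduce ha m f : ℂ × Circ → ℂ) =ᵐ[volSM] fun s =>
        g₀ s.1 + xPerp p q s + ∑ k ∈ Finset.Icc 1 m, g k s := by
  set F := reduce ha m f
  obtain ⟨g₀, t, ht, g, hg, hF⟩ : ∃ g₀ : L2M, ∃ t ∈ H10, ∃ g : ℕ → L2SM,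
      (∀ k ∈ Finset.Icc 1 m, g k ∈ Hsol k) ∧
      F = mode 0 g₀ + (mode 1 (-I • wirt (-I) t) + mode (-1) (I • wirt I t)) +
        ∑ k ∈ Finset.Icc 1 m, g k := by
    have hFm : F ∈ L2Deg m := reduce_mem_L2Deg ha le_rfl hf
    have hdec := eq_of_coeff_eq hFm
    rcases Nat.eq_zero_or_pos m with rfl | hm
    · refine ⟨coeff 0 F, 0, H10.zero_mem, fun _ => 0, fun k hk => by simp at hk, ?_⟩
      simpa using hdec
    · obtain ⟨n, rfl⟩ : ∃ n, m = n + 1 := ⟨m - 1, by omega⟩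
      obtain ⟨s, s', t, hs, hs', ht, h1, h2⟩ := exists_coeff_one_reduce ha n f
      have hIcc : Finset.Icc 1 (n + 1) = insert 1 (Finset.Icc 2 (n + 1)) := by
        ext j; simp only [Finset.mem_insert, Finset.mem_Icc]; omega
      set g : ℕ → L2SM := fun k =>
        if k = 1 then mode 1 s + mode (-1) s' else mode k (coeff k F) + mode (-k) (coeff (-k) F)
      refine ⟨coeff 0 F, t, ht, g, fun k hk => ?_, ?_⟩
      · rw [Finset.mem_Icc] at hk
        by_cases hk1 : k = 1
        · subst hk1
          exact ⟨s, s', hs, hs', harmonicFun_ae_eq_mode_add 1 s s'⟩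
        · obtain ⟨j, rfl⟩ : ∃ j, k = j + 2 := ⟨k - 2, by omega⟩
          have h := isHolo_coeff_reduce ha (j := j) hk.2 f
          refine ⟨_, _, h.1, h.2, ?_⟩
          simp only [g, if_neg hk1]
          exact harmonicFun_ae_eq_mode_add _ _ _
      · have hsum : ∑ k ∈ Finset.Icc 2 (n + 1), g k = ∑ k ∈ Finset.Icc 2 (n + 1),
            (mode k (coeff k F) + mode (-k) (coeff (-k) F)) := by
          refine Finset.sum_congr rfl fun k hk => ?_
          rw [Finset.mem_Icc] at hk
          exact if_neg (by omega)
        have hg1 : g 1 = mode 1 s + mode (-1) s' := if_pos rfl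
        rw [hIcc, Finset.sum_insert (by simp), hsum, hg1]
        rw [hIcc, Finset.sum_insert (by simp), Nat.cast_one, h1, h2, map_sub, map_add] at hdec
        conv_lhs => rw [hdec]
        rw [neg_smul, map_neg]
        abel
  refine ⟨g₀, t.1, t.2.1, t.2.2, g, hasH10Grad_iff.2 ht, hg, ?_⟩
  rw [hF]
  filter_upwards [Lp.coeFn_add (mode 0 g₀ +
      (mode 1 (-I • wirt (-I) t) + mode (-1) (I • wirt I t))) (∑ k ∈ Finset.Icc 1 m, g k),
    Lp.coeFn_add (mode 0 g₀) (mode 1 (-I • wirt (-I) t) + mode (-1) (I • wirt I t)),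
    coeFn_finset_sum (Finset.Icc 1 m) g, mode_zero_ae_eq g₀, xPerp_ae_eq t]
    with s h1 h2 h3 h4 h5
  rw [h1, Pi.add_apply, h2, Pi.add_apply, h3, h4, h5]

end AttXray

end

theorem theorem2p1 (a : ℂ → ℂ) (ha : ContinuousOn a AttXray.disc) (m : ℕ) :
    ∃ G : AttXray.L2Deg m →ₗ[ℂ] AttXray.L2Deg m, ∀ f : AttXray.L2Deg m,
      (AttXray.attXray a (f : AttXray.L2SM) =ᵐ[AttXray.volBdry]
        AttXray.attXray a (G f : AttXray.L2SM)) ∧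
      (∃ (g₀ gs p q : AttXray.L2M) (g : ℕ → AttXray.L2SM),
        AttXray.HasH10Grad gs p q ∧
        (∀ k ∈ Finset.Icc 1 m, g k ∈ AttXray.Hsol k) ∧
        ((G f : AttXray.L2SM) : ℂ × AttXray.Circ → ℂ) =ᵐ[AttXray.volSM] fun s =>
          g₀ s.1 + AttXray.xPerp p q s + ∑ k ∈ Finset.Icc 1 m, g k s) ∧
      (∀ fk : ℕ → AttXray.L2SM, (∀ k ∈ Finset.range (m + 1), fk k ∈ AttXray.H k) →
        (f : AttXray.L2SM) = ∑ k ∈ Finset.range (m + 1), fk k →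
        (m = 1 → ‖G f‖ ^ 2 ≤ 2 * ‖fk 0‖ ^ 2 +
          (1 + 4 * AttXray.supM a ^ 2 * AttXray.poincareConst) * ‖fk 1‖ ^ 2) ∧
        (2 ≤ m → ‖G f‖ ^ 2 ≤
          4 * ∑ k ∈ Finset.range (m - 1), AttXray.stabConst a ^ k * ‖fk k‖ ^ 2 +
          2 * AttXray.stabConst a ^ (m - 1) * ‖fk (m - 1)‖ ^ 2 +
          AttXray.stabConst a ^ m * ‖fk m‖ ^ 2)) := by
  refine ⟨(AttXray.reduce ha m).restrict fun f hf => AttXray.reduce_mem_L2Deg ha le_rfl hf,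
    fun f => ⟨AttXray.attXray_eq_of_sub_mem ha (AttXray.sub_reduce_mem ha m f),
      AttXray.exists_normal_form ha f.2, fun fk hk hf => ?_⟩⟩
  have hnorm : ‖(AttXray.reduce ha m).restrict
      (fun f hf => AttXray.reduce_mem_L2Deg ha le_rfl hf) f‖ ^ 2 =
      AttXray.reducedEnergy ha m f :=
    AttXray.norm_sq_eq_sum_energy (AttXray.reduce_mem_L2Deg ha le_rfl f.2)
  have hE : ∀ k ≤ m, AttXray.energy k f = ‖fk k‖ ^ 2 := fun k hkm => by
    rw [hf]; exact AttXray.energy_sum_eq hk hkm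
  rw [hnorm]
  refine ⟨?_, fun hm => ?_⟩
  · rintro rfl
    rw [← hE 0 (by omega), ← hE 1 le_rfl]
    exact AttXray.reducedEnergy_one_le ha f
  · obtain ⟨n, rfl⟩ : ∃ n, m = n + 2 := ⟨m - 2, by omega⟩
    have h := AttXray.reducedEnergy_le ha n f
    rw [Finset.sum_congr rfl fun k hk => by
      rw [hE k (by have := Finset.mem_range.1 hk; omega)], hE (n + 1) (by omega),
      hE (n + 2) le_rfl] at h
    exact h
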